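/- Let $0<m_1<n$ be integers and let $p$ be a probability distribution on $\{0,1,\dots,n\}$. Consider the memoryless broadcast channel whose input is a bit vector $X=(X^1,\dots,X^n)$ (most significant bit first). In each use, receiver 1 observes $Y_1=(X^1,\dots,X^{m_1})$ and receiver 2 observes $Y_2=(M_2,X^1,\dots,X^{M_2})$, where the fading states $M_2\sim p$ are i.i.d. over time, independent of the inputs and unknown to the transmitter and to receiver 1. Entropies and rates are in bits, and auxiliary variables have finite alphabets and are, jointly with $X$, independent of $M_2$. Put $q(j)=P[M_2\ge j]$, so that $q$ is non-increasing, and for $\mu\ge 0$ put $$F(\mu)=\sum_{j=1}^{m_1}\max\{1,\mu q(j)\}+\mu\sum_{j=m_1+1}^{n}q(j).$$ **(a) Evaluation of the optimization problem.** For every $\mu\ge0$, $$\max_{p(v,x)}\; I(X;Y_1|V)+\mu I(V;Y_2)=F(\mu).$$ There is exactly one $i_0\in\{0,\dots,m_1\}$ with $\mu q(i_0)\ge 1$ (required only if $i_0>0$) and $\mu q(i_0+1)<1$ (required only if $i_0<m_1$). The maximum is attained by independent uniform bits $X^1,\dots,X^n$ and $V=(X^1,\dots,X^{i_0},X^{m_1+1},\dots,X^n)$.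 Conversely, every maximizing $p(v,x)$ satisfies, for every $j\in\{1,\dots,n\}$: - $H(X^j|X^1,\dots,X^{j-1})=1$ if $j\le m_1$ or $\mu q(j)>0$; - $H(X^j|V)=0$ if $j\le m_1$ and $\mu q(j)>1$; - $H(X^j|V,X^1,\dots,X^{j-1})=1$ if $j\le m_1$ and $\mu q(j)<1$; - $H(X^j|V,X^1,\dots,X^{j-1})=0$ if $j>m_1$ and $\mu q(j)>0$. **(b) Rates of the bit assignments.** For $0\le i_0\le m_1$ let $X$ be uniform, $V=(X^1,\dots,X^{i_0},X^{m_1+1},\dots,X^n)$ and $U=(X^{i_0+1},\dots,X^{m_1})$. Then $I(U;V)=0$, $I(U;Y_1)=I(X;Y_1|V)=m_1-i_0$ and $$I(V;Y_2)=r(i_0):=\sum_{i=1}^{i_0}i\,p(i)+i_0\sum_{i=i_0+1}^{m_1}p(i)+\sum_{i=m_1+1}^{n}(i_0+i-m_1)\,p(i).$$ All rate pairs in $[0,m_1-i_0]\times[0,r(i_0)]$ are in the closure of the rates achievable by superposition codes in which, at every time, the bits $X^{i_0+1},\dots,X^{m_1}$ are a function of receiver 1's message alone and all other bits a function of receiver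 2's message alone. **(c) Capacity region.** Let $$\mathcal R=\operatorname{conv}\Big(\bigcup_{i_0=0}^{m_1}[0,m_1-i_0]\times[0,r(i_0)]\Big).$$ Then $\mathcal R=\{(R_1,R_2): R_1,R_2\ge0,\ R_1+\mu R_2\le F(\mu)\text{ for all }\mu\ge0\}$, and $\mathcal R$ is equal to each of the following: - the set $\mathcal O_2$ of pairs $R_1,R_2\ge0$ with $R_1\le I(X;Y_1)$, $R_2\le I(V;Y_2)$, $R_1+R_2\le I(X;Y_1|V)+I(V;Y_2)$ for some $p(v,x)$; - the Körner–Marton outer bound $\mathcal O_2\cap\mathcal O_1$, where $\mathcal O_1$ is the set of pairs $R_1,R_2\ge0$ with $R_2\le I(X;Y_2)$, $R_1\le I(U;Y_1)$, $R_1+R_2\le I(X;Y_2|U)+I(U;Y_1)$ for some $p(u,x)$; - the closure of the rates achievable by superposition codes as in (b) in which $i_0\in\{0,\dots,m_1\}$ may vary with time (time sharing); - the capacity region of the channel, that is, the closure of the set of pairs $R_1,R_2\ge0$ for which there are block codes of length $N$ with $\lceil 2^{NR_1}\rceil$ and $\lceil 2^{NR_2}\rceil$ private messages for receivers 1 and 2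 and average error probability tending to $0$ as $N\to\infty$. -/

import Mathlib

open Filter Topology

namespace FadingBC

noncomputable section

/-! ### Information measures of finite random variables, in bits -/

section Information

variable {Ω α β γ : Type*} [Fintype Ω] [Fintype α] [Fintype β] [Fintype γ]

open Classical in
/-- The law of the random variable `f` when the sample space `Ω` carries the weights `P`. -/
def law (P : Ω → ℝ) (f : Ω → α) (a : α) : ℝ :=
  ∑ ω, if f ω = a then P ω else 0

/-- The entropy `H(f)`. -/
def entropy (P : Ω → ℝ) (f : Ω → α) : ℝ :=
  -∑ a, law P f a * Real.logb 2 (law P f a)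

/-- The conditional entropy `H(f | g) = - ∑ P(a, b) log P(a | b)`. -/
def condEntropy (P : Ω → ℝ) (f : Ω → α) (g : Ω → β) : ℝ :=
  -∑ a, ∑ b, law P (fun ω => (f ω, g ω)) (a, b) *
    Real.logb 2 (law P (fun ω => (f ω, g ω)) (a, b) / law P g b)

/-- The mutual information `I(f; g) = H(f) - H(f | g)`. -/
def mutualInfo (P : Ω → ℝ) (f : Ω → α) (g : Ω → β) : ℝ :=
  entropy P f - condEntropy P f g

/-- The conditional mutual information `I(f; g | h) = H(f | h) - H(f | g, h)`. -/
def condMutualInfo (P : Ω → ℝ) (f : Ω → α) (g : Ω → β) (h : Ω → γ) : ℝ :=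
  condEntropy P f h - condEntropy P f (fun ω => (g ω, h ω))

end Information

/-! ### The channel -/

/-- Channel inputs: `n` bits, most significant first; the bit `X^j` is `x (j - 1)`. -/
abbrev Input (n : ℕ) : Type := Fin n → Bool

/-- Values of the `m` most significant bits. -/
abbrev TopBits (n m : ℕ) : Type := {j : Fin n // j.val < m} → Bool

/-- The `m` most significant bits of an input. With `m = m₁` this is the output `Y₁`. -/
def topBits {n : ℕ} (m : ℕ) (x : Input n) : TopBits n m := fun j => x j.1

/-- What receiver 2 observes: the number `i` of received bits, and those bits. -/
abbrev FadedOutput (n : ℕ) : Type := Σ i : Fin (n + 1), TopBits n i.val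

/-- The output `Y₂` when `M₂ = i`. -/
def fadedOutput {n : ℕ} (i : Fin (n + 1)) (x : Input n) : FadedOutput n :=
  ⟨i, topBits i.val x⟩

/-- `q(j) = P[M₂ ≥ j]`. -/
def tail {n : ℕ} (p : Fin (n + 1) → ℝ) (j : ℕ) : ℝ :=
  ∑ i : Fin (n + 1), if j ≤ i.val then p i else 0

/-! ### Single-letter quantities

The sample space is `V × Input n × Fin (n + 1)`: auxiliary variable, input, fading state. -/

section SingleLetter

variable {n : ℕ} {V : Type} [Fintype V]

/-- `(V, X)` has law `P`, and `M₂` has law `p` and is independent of `(V, X)`. -/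
def withFading (p : Fin (n + 1) → ℝ) (P : V × Input n → ℝ) : V × Input n × Fin (n + 1) → ℝ :=
  fun ω => P (ω.1, ω.2.1) * p ω.2.2

/-- The auxiliary variable. -/
def rvV (ω : V × Input n × Fin (n + 1)) : V := ω.1

/-- The input `X`. -/
def rvX (ω : V × Input n × Fin (n + 1)) : Input n := ω.2.1

/-- The output `Y₁`. -/
def rvY₁ (m₁ : ℕ) (ω : V × Input n × Fin (n + 1)) : TopBits n m₁ := topBits m₁ ω.2.1

/-- The output `Y₂`, which includes the state `M₂` known to receiver 2. -/
def rvY₂ (ω : V × Input n × Fin (n + 1)) : FadedOutput n := fadedOutput ω.2.2 ω.2.1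

/-- The objective `I(X; Y₁ | V) + μ I(V; Y₂)`. -/
def objective (m₁ : ℕ) (p : Fin (n + 1) → ℝ) (μ : ℝ) (P : V × Input n → ℝ) : ℝ :=
  condMutualInfo (withFading p P) rvX (rvY₁ m₁) rvV + μ * mutualInfo (withFading p P) rvV rvY₂

end SingleLetter

/-- The part of the Körner–Marton outer bound in which the auxiliary variable belongs to
receiver 2. -/
def kornerMartonTwo {n : ℕ} (m₁ : ℕ) (p : Fin (n + 1) → ℝ) : Set (ℝ × ℝ) :=
  {R | 0 ≤ R.1 ∧ 0 ≤ R.2 ∧ ∃ (V : Type) (_ : Fintype V) (P : V × Input n → ℝ),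
    P ∈ stdSimplex ℝ (V × Input n) ∧
    R.1 ≤ mutualInfo (withFading p P) rvX (rvY₁ m₁) ∧
    R.2 ≤ mutualInfo (withFading p P) rvV rvY₂ ∧
    R.1 + R.2 ≤ condMutualInfo (withFading p P) rvX (rvY₁ m₁) rvV
      + mutualInfo (withFading p P) rvV rvY₂}

/-- The part of the Körner–Marton outer bound in which the auxiliary variable belongs to
receiver 1. -/
def kornerMartonOne {n : ℕ} (m₁ : ℕ) (p : Fin (n + 1) → ℝ) : Set (ℝ × ℝ) :=
  {R | 0 ≤ R.1 ∧ 0 ≤ R.2 ∧ ∃ (U : Type) (_ : Fintype U) (P : U × Input n → ℝ),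
    P ∈ stdSimplex ℝ (U × Input n) ∧
    R.2 ≤ mutualInfo (withFading p P) rvX rvY₂ ∧
    R.1 ≤ mutualInfo (withFading p P) rvV (rvY₁ m₁) ∧
    R.1 + R.2 ≤ condMutualInfo (withFading p P) rvX rvY₂ rvV
      + mutualInfo (withFading p P) rvV (rvY₁ m₁)}

/-- The Körner–Marton outer bound. -/
def kornerMartonRegion {n : ℕ} (m₁ : ℕ) (p : Fin (n + 1) → ℝ) : Set (ℝ × ℝ) :=
  kornerMartonTwo m₁ p ∩ kornerMartonOne m₁ p

/-! ### The bit assignment -/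

/-- The values of the bits assigned to receiver 2: `X^1, …, X^{i₀}` and `X^{m₁+1}, …, X^n`. -/
abbrev VBits (n m₁ i₀ : ℕ) : Type := {j : Fin n // j.val < i₀ ∨ m₁ ≤ j.val} → Bool

/-- The bits of `x` assigned to receiver 2. -/
def vBits {n : ℕ} (m₁ i₀ : ℕ) (x : Input n) : VBits n m₁ i₀ := fun j => x j.1

/-- The bits `X^{i₀+1}, …, X^{m₁}` of `x`, assigned to receiver 1. -/
def uBits {n : ℕ} (m₁ i₀ : ℕ) (x : Input n) :
    {j : Fin n // i₀ ≤ j.val ∧ j.val < m₁} → Bool := fun j => x j.1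

open Classical in
/-- The law of `(V, X)` where the bits of `X` are independent and uniform, and `V` consists of
the bits of `X` assigned to receiver 2. -/
def bitLaw (n m₁ i₀ : ℕ) : VBits n m₁ i₀ × Input n → ℝ :=
  fun z => if z.1 = vBits m₁ i₀ z.2 then ((2 : ℝ) ^ n)⁻¹ else 0

/-- `i₀` is the number of leading bits given to receiver 2: `q(i₀) ≥ 1/μ > q(i₀ + 1)`, with the
obvious changes when `i₀ = 0` or `i₀ = m₁`. -/
def IsThreshold {n : ℕ} (m₁ : ℕ) (p : Fin (n + 1) → ℝ) (μ : ℝ) (i₀ : ℕ) : Prop :=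
  i₀ ≤ m₁ ∧ (0 < i₀ → 1 ≤ μ * tail p i₀) ∧ (i₀ < m₁ → μ * tail p (i₀ + 1) < 1)

/-- The value of the optimization problem. -/
def optValue {n : ℕ} (m₁ : ℕ) (p : Fin (n + 1) → ℝ) (μ : ℝ) : ℝ :=
  ∑ j ∈ Finset.Icc 1 m₁, max 1 (μ * tail p j) + μ * ∑ j ∈ Finset.Icc (m₁ + 1) n, tail p j

/-- The expected number of bits assigned to receiver 2 that receiver 2 sees. The subtraction is
meant to truncate: when `M₂ = i`, it sees `min i i₀` of the top bits and `max (i - m₁) 0` of the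
bottom ones. -/
def rate₂ {n : ℕ} (m₁ : ℕ) (p : Fin (n + 1) → ℝ) (i₀ : ℕ) : ℝ :=
  ∑ i : Fin (n + 1), p i * ((min i.val i₀ + (i.val - m₁) : ℕ) : ℝ)

/-- The rate rectangle that belongs to the bit assignment with parameter `i₀`. -/
def rectangle {n : ℕ} (m₁ : ℕ) (p : Fin (n + 1) → ℝ) (i₀ : ℕ) : Set (ℝ × ℝ) :=
  {R | 0 ≤ R.1 ∧ R.1 ≤ (m₁ : ℝ) - i₀ ∧ 0 ≤ R.2 ∧ R.2 ≤ rate₂ m₁ p i₀}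

/-- The convex hull of the rate rectangles of all bit assignments. -/
def explicitRegion {n : ℕ} (m₁ : ℕ) (p : Fin (n + 1) → ℝ) : Set (ℝ × ℝ) :=
  convexHull ℝ (⋃ i₀ ∈ Finset.range (m₁ + 1), rectangle m₁ p i₀)

/-! ### Codes and capacity -/

/-- A block code of length `N` with `K₁` messages for receiver 1 and `K₂` for receiver 2. The
encoder does not know the fading states; decoder 2 sees them in its outputs. -/
structure Code (n m₁ N K₁ K₂ : ℕ) where
  enc : Fin K₁ → Fin K₂ → Fin N → Input n
  dec₁ : (Fin N → TopBits n m₁) → Fin K₁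
  dec₂ : (Fin N → FadedOutput n) → Fin K₂

namespace Code

variable {n m₁ N K₁ K₂ : ℕ}

open Classical in
/-- The average probability that some receiver decodes its message wrongly, for independent
uniform messages and independent fading states of law `p`. -/
def errorProb (c : Code n m₁ N K₁ K₂) (p : Fin (n + 1) → ℝ) : ℝ :=
  ((K₁ : ℝ) * K₂)⁻¹ * ∑ w₁ : Fin K₁, ∑ w₂ : Fin K₂, ∑ s : Fin N → Fin (n + 1),
    (∏ t, p (s t)) *
      if c.dec₁ (fun t => topBits m₁ (c.enc w₁ w₂ t)) = w₁ ∧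
        c.dec₂ (fun t => fadedOutput (s t) (c.enc w₁ w₂ t)) = w₂ then 0 else 1

/-- Superposition by bit assignment: at time `t`, the bits `X^{a(t)+1}, …, X^{m₁}` carry the
message of receiver 1, and all other bits that of receiver 2. -/
def IsSuperposition (c : Code n m₁ N K₁ K₂) (a : Fin N → ℕ) : Prop :=
  ∃ (u : Fin K₁ → Fin N → Input n) (v : Fin K₂ → Fin N → Input n), ∀ w₁ w₂ t j,
    c.enc w₁ w₂ t j = if a t ≤ j.val ∧ j.val < m₁ then u w₁ t j else v w₂ t j

end Code

/-- The closure of the set of rate pairs (in bits per channel use) achievable by codes with the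
property `C`. -/
def rateRegion {n m₁ : ℕ} (p : Fin (n + 1) → ℝ)
    (C : ∀ {N K₁ K₂ : ℕ}, Code n m₁ N K₁ K₂ → Prop) : Set (ℝ × ℝ) :=
  closure {R | 0 ≤ R.1 ∧ 0 ≤ R.2 ∧
    ∃ c : ∀ N : ℕ, Code n m₁ N ⌈(2 : ℝ) ^ ((N : ℝ) * R.1)⌉₊ ⌈(2 : ℝ) ^ ((N : ℝ) * R.2)⌉₊,
      (∀ N, C (c N)) ∧ Tendsto (fun N => (c N).errorProb p) atTop (𝓝 0)}

/-- The capacity region. -/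
def capacityRegion {n : ℕ} (m₁ : ℕ) (p : Fin (n + 1) → ℝ) : Set (ℝ × ℝ) :=
  rateRegion (m₁ := m₁) p (fun _ => True)

/-- The rates of superposition codes in which the bit assignment may vary with time (time
sharing). -/
def superpositionRegion {n : ℕ} (m₁ : ℕ) (p : Fin (n + 1) → ℝ) : Set (ℝ × ℝ) :=
  rateRegion (m₁ := m₁) p (fun {N _ _} c =>
    ∃ a : Fin N → ℕ, (∀ t, a t ≤ m₁) ∧ c.IsSuperposition a)

/-- The rates of superposition codes that use the same bit assignment `i₀` at all times. -/
def fixedSuperpositionRegion {n : ℕ} (m₁ : ℕ) (p : Fin (n + 1) → ℝ) (i₀ : ℕ) : Set (ℝ × ℝ) :=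
  rateRegion (m₁ := m₁) p (fun c => c.IsSuperposition (fun _ => i₀))

end

end FadingBC

/-!
All information quantities of the single-letter problem are expressed by the entropies of the
individual bits, `a_j = H(X^j | X^1, …, X^{j-1})` and `b_j = H(X^j | V, X^1, …, X^{j-1})`, which
satisfy `0 ≤ b_j ≤ a_j ≤ 1`. The chain rule gives `I(X; Y₁ | V) = ∑_{j ≤ m₁} b_j`, and summation by
parts over the fading state gives `I(V; Y₂) = ∑_j q(j) (a_j - b_j)`. The objective is therefore a
sum of terms that are maximized separately (`objective_eq`, `bit_contribution_le`), which yields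
its maximum and the conditions for equality. For the bit assignments the `b_j` are `0` or `1`
(`bitEntropy_bitLaw`).

The hull of the rectangles is the intersection of the half planes `R₁ + μ R₂ ≤ F(μ)` because
`F(μ)` is the maximum over the corner points, attained at the threshold (`corner_le_optValue`,
`corner_eq_optValue`, `dualRegion_subset_explicitRegion`). The Körner–Marton bound `𝒪₂` is
contained in these half planes by the single-letter problem; it contains the hull because the
choice of the bit assignment can be made part of the auxiliary variable (`timeSharingLaw`). The
largest individual and sum rates of the hull meet the bounds of `𝒪₁` with `U = Y₁`.

For the converse, Fano's inequality is applied to receiver 2 for each fading sequence separately.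
Dropping the bits below level `m₁` only decreases `H(Y₂ | W₂)`; after that, conditioning on the
whole past of `Y₁` in the chain rule over time decreases it further. Then `H(Y₁ | W₂)` and the lower
bound for `H(Y₂ | W₂)` are sums of the same conditional bit entropies, and a block is bounded term
by term as in the single-letter problem (`block_bound`), without an auxiliary sum identity.

For achievability, receiver 1 gets uncoded bits and receiver 2 a random codebook; receiver 2 looks
for the message that is consistent with the bits it sees. The error probability is bounded in
Gallager's form `(K₂ - 1)^ρ ∏_t E[2^(-ρ c_t)]`, where `c_t` is the number of bits assigned to
receiver 2 that it sees at time `t`. If the rate is below the mean of the `c_t`, this tends to `0`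
for a suitably small `ρ` (`exists_codes_of_schedule`). Time sharing follows a schedule with prescribed frequencies
(`exists_schedule`).
-/

namespace FadingBC

/-! ### Entropy calculus -/

section Law

variable {Ω α β : Type*} [Fintype Ω]

theorem law_nonneg {P : Ω → ℝ} (hP : ∀ ω, 0 ≤ P ω) (f : Ω → α) (a : α) : 0 ≤ law P f a := by
  classical
  exact Finset.sum_nonneg fun ω _ => by split_ifs <;> simp [hP]

theorem sum_law_mul [Fintype α] (P : Ω → ℝ) (f : Ω → α) (F : α → ℝ) :
    ∑ a, law P f a * F a = ∑ ω, P ω * F (f ω) := by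
  classical
  simp only [law, Finset.sum_mul]
  rw [Finset.sum_comm]
  refine Finset.sum_congr rfl fun ω _ => ?_
  simp [ite_mul]

theorem law_le_law {P : Ω → ℝ} (hP : ∀ ω, 0 ≤ P ω) {f : Ω → α} {g : Ω → β} {a : α} {b : β}
    (h : ∀ ω, f ω = a → g ω = b) : law P f a ≤ law P g b := by
  classical
  refine Finset.sum_le_sum fun ω _ => ?_
  by_cases hf : f ω = a
  · simp [hf, h ω hf]
  · simp only [hf, if_false]
    split_ifs <;> simp [hP]

theorem le_law {P : Ω → ℝ} (hP : ∀ ω, 0 ≤ P ω) (f : Ω → α) (ω : Ω) : P ω ≤ law P f (f ω) := by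
  classical
  have := Finset.single_le_sum (f := fun ω' => if f ω' = f ω then P ω' else 0)
    (fun ω' _ => by split_ifs <;> simp [hP]) (Finset.mem_univ ω)
  simpa [law] using this

theorem law_congr {P : Ω → ℝ} {f : Ω → α} {g : Ω → β} {a : α} {b : β}
    (h : ∀ ω, P ω ≠ 0 → (f ω = a ↔ g ω = b)) : law P f a = law P g b := by
  classical
  refine Finset.sum_congr rfl fun ω _ => ?_
  by_cases h0 : P ω = 0
  · simp [h0]
  · simp only [h ω h0]

theorem law_law [Fintype α] (P : Ω → ℝ) (f : Ω → α) (g : α → β) :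
    law (law P f) g = law P (fun ω => g (f ω)) := by
  classical
  funext c
  have := sum_law_mul P f fun a => if g a = c then (1 : ℝ) else 0
  simpa [law, mul_ite] using this

end Law

section Calculus

variable {Ω Ω' α β γ ι : Type*} [Fintype Ω] [Fintype Ω'] [Fintype α] [Fintype β] [Fintype γ]
  [Fintype ι]

theorem sum_law (P : Ω → ℝ) (f : Ω → α) : ∑ a, law P f a = ∑ ω, P ω := by
  simpa using sum_law_mul P f fun _ => 1

theorem law_mem_stdSimplex {P : Ω → ℝ} (hP : P ∈ stdSimplex ℝ Ω) (f : Ω → α) :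
    law P f ∈ stdSimplex ℝ α :=
  ⟨law_nonneg hP.1 f, (sum_law P f).trans hP.2⟩

/-- Entropy as the expected surprise of the sample point: only the partition of the sample space
by the values of `f` matters. -/
theorem entropy_eq_sum (P : Ω → ℝ) (f : Ω → α) :
    entropy P f = -∑ ω, P ω * Real.logb 2 (law P f (f ω)) := by
  rw [entropy, sum_law_mul P f fun a => Real.logb 2 (law P f a)]

theorem condEntropy_eq_sum (P : Ω → ℝ) (f : Ω → α) (g : Ω → β) :
    condEntropy P f g = -∑ ω, P ω *
      Real.logb 2 (law P (fun ω => (f ω, g ω)) (f ω, g ω) / law P g (g ω)) := by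
  rw [condEntropy, ← sum_law_mul P (fun ω => (f ω, g ω)) fun z =>
    Real.logb 2 (law P (fun ω => (f ω, g ω)) z / law P g z.2), Fintype.sum_prod_type]

/-- Two random variables that determine each other on the support have the same entropy. -/
theorem entropy_congr {P : Ω → ℝ} {f : Ω → α} {g : Ω → β}
    (h : ∀ ω ω', P ω ≠ 0 → P ω' ≠ 0 → (f ω = f ω' ↔ g ω = g ω')) :
    entropy P f = entropy P g := by
  rw [entropy_eq_sum, entropy_eq_sum]
  congr 1
  refine Finset.sum_congr rfl fun ω _ => ?_
  by_cases h0 : P ω = 0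
  · simp [h0]
  · rw [law_congr (g := g) (b := g ω) fun ω' h1 => h ω' ω h1 h0]

theorem entropy_law (P : Ω → ℝ) (φ : Ω → Ω') (f : Ω' → α) :
    entropy (law P φ) f = entropy P (fun ω => f (φ ω)) := by
  rw [entropy, entropy, law_law]

theorem condEntropy_eq {P : Ω → ℝ} (hP : ∀ ω, 0 ≤ P ω) (f : Ω → α) (g : Ω → β) :
    condEntropy P f g = entropy P (fun ω => (f ω, g ω)) - entropy P g := by
  rw [condEntropy_eq_sum, entropy_eq_sum, entropy_eq_sum, neg_sub_neg, ← Finset.sum_sub_distrib,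
    ← Finset.sum_neg_distrib]
  refine Finset.sum_congr rfl fun ω _ => ?_
  by_cases h0 : P ω = 0
  · simp [h0]
  · have h1 : 0 < P ω := lt_of_le_of_ne (hP ω) (Ne.symm h0)
    have h2 := h1.trans_le (le_law hP (fun ω => (f ω, g ω)) ω)
    have h3 := h1.trans_le (le_law hP g ω)
    rw [Real.logb_div h2.ne' h3.ne']
    ring

theorem mutualInfo_eq {P : Ω → ℝ} (hP : ∀ ω, 0 ≤ P ω) (f : Ω → α) (g : Ω → β) :
    mutualInfo P f g = entropy P f + entropy P g - entropy P (fun ω => (f ω, g ω)) := by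
  rw [mutualInfo, condEntropy_eq hP]
  ring

/-- If `f` determines `g`, then `I(f; g | h) = H(g | h)`. -/
theorem condMutualInfo_eq_of_determines {P : Ω → ℝ} (hP : ∀ ω, 0 ≤ P ω) {f : Ω → α} {g : Ω → β}
    (h : Ω → γ) (hfg : ∀ ω ω', f ω = f ω' → g ω = g ω') :
    condMutualInfo P f g h = entropy P (fun ω => (g ω, h ω)) - entropy P h := by
  have : entropy P (fun ω => (f ω, g ω, h ω)) = entropy P (fun ω => (f ω, h ω)) :=
    entropy_congr fun ω ω' _ _ => by
      simp only [Prod.mk.injEq]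
      exact ⟨fun h => ⟨h.1, h.2.2⟩, fun h => ⟨h.1, hfg _ _ h.1, h.2⟩⟩
  rw [condMutualInfo, condEntropy_eq hP, condEntropy_eq hP, this]
  ring

theorem condEntropy_nonneg {P : Ω → ℝ} (hP : ∀ ω, 0 ≤ P ω) (f : Ω → α) (g : Ω → β) :
    0 ≤ condEntropy P f g := by
  rw [condEntropy_eq_sum, ← Finset.sum_neg_distrib]
  refine Finset.sum_nonneg fun ω _ => ?_
  have h1 : law P (fun ω => (f ω, g ω)) (f ω, g ω) ≤ law P g (g ω) :=
    law_le_law hP fun ω' h => (Prod.mk.inj h).2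
  have h2 : Real.logb 2 (law P (fun ω => (f ω, g ω)) (f ω, g ω) / law P g (g ω)) ≤ 0 :=
    Real.logb_nonpos one_lt_two (div_nonneg (law_nonneg hP _ _) (law_nonneg hP _ _))
      (div_le_one_of_le₀ h1 (law_nonneg hP _ _))
  have := mul_nonneg (hP ω) (neg_nonneg.2 h2)
  linarith

/-- Gibbs' inequality: the cross entropy relative to any conditional (sub)probability `Q(a | b)`
bounds the conditional entropy. Conditioning reduces entropy, `H ≤ log |α|`, and Fano's inequality
are the choices `Q(a | b) = P(a | h(b))`, the uniform one, and a half-and-half mixture of the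
uniform one with a point mass. -/
theorem condEntropy_le_cross {P : Ω → ℝ} (hP : P ∈ stdSimplex ℝ Ω) (f : Ω → α) (g : Ω → β)
    (Q : α → β → ℝ) (hQ : ∀ a b, 0 ≤ Q a b) (hQpos : ∀ ω, P ω ≠ 0 → 0 < Q (f ω) (g ω))
    (hQsum : ∀ b, ∑ a, Q a b ≤ 1) :
    condEntropy P f g ≤ -∑ ω, P ω * Real.logb 2 (Q (f ω) (g ω)) := by
  set L := law P (fun ω => (f ω, g ω)) with hL
  have hL0 : ∀ z, 0 ≤ L z := law_nonneg hP.1 _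
  have hg0 : ∀ b, 0 ≤ law P g b := law_nonneg hP.1 _
  -- the two sides differ by an expected log-ratio; apply `log x ≤ x - 1` to it
  have key : ∑ ω, P ω * Real.log (Q (f ω) (g ω) * law P g (g ω) / L (f ω, g ω)) ≤ 0 := by
    calc ∑ ω, P ω * Real.log (Q (f ω) (g ω) * law P g (g ω) / L (f ω, g ω))
        ≤ ∑ ω, P ω * (Q (f ω) (g ω) * law P g (g ω) / L (f ω, g ω) - 1) := by
          refine Finset.sum_le_sum fun ω _ => ?_
          by_cases h0 : P ω = 0
          · simp [h0]
          · have h1 : 0 < P ω := lt_of_le_of_ne (hP.1 ω) (Ne.symm h0)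
            have h2 := h1.trans_le (le_law hP.1 (fun ω => (f ω, g ω)) ω)
            have h3 := h1.trans_le (le_law hP.1 g ω)
            exact mul_le_mul_of_nonneg_left
              (Real.log_le_sub_one_of_pos (div_pos (mul_pos (hQpos ω h0) h3) h2)) h1.le
      _ = ∑ z : α × β, L z * (Q z.1 z.2 * law P g z.2 / L z) - 1 := by
          rw [hL, sum_law_mul P (fun ω => (f ω, g ω))
            (fun z : α × β => Q z.1 z.2 * law P g z.2 / law P (fun ω => (f ω, g ω)) z)]
          simp only [mul_sub, Finset.sum_sub_distrib, mul_one, hP.2]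
      _ ≤ ∑ z : α × β, Q z.1 z.2 * law P g z.2 - 1 := by
          refine sub_le_sub_right (Finset.sum_le_sum fun z _ => ?_) 1
          by_cases h0 : L z = 0
          · simpa [h0] using mul_nonneg (hQ z.1 z.2) (hg0 z.2)
          · rw [mul_div_cancel₀ _ h0]
      _ = ∑ b, (∑ a, Q a b) * law P g b - 1 := by
          rw [Fintype.sum_prod_type, Finset.sum_comm]
          simp [Finset.sum_mul]
      _ ≤ ∑ b, 1 * law P g b - 1 := by
          gcongr with b
          · exact hg0 b
          · exact hQsum b
      _ = 0 := by simp [sum_law, hP.2]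
  have hlog : 0 < Real.log 2 := Real.log_pos one_lt_two
  rw [condEntropy_eq_sum, ← sub_nonpos, neg_sub_neg, ← Finset.sum_sub_distrib]
  have : ∑ ω, (P ω * Real.logb 2 (Q (f ω) (g ω)) - P ω * Real.logb 2 (L (f ω, g ω) / law P g (g ω)))
      = (∑ ω, P ω * Real.log (Q (f ω) (g ω) * law P g (g ω) / L (f ω, g ω))) / Real.log 2 := by
    rw [Finset.sum_div]
    refine Finset.sum_congr rfl fun ω _ => ?_
    by_cases h0 : P ω = 0
    · simp [h0]
    · have h1 : 0 < P ω := lt_of_le_of_ne (hP.1 ω) (Ne.symm h0)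
      have h2 := h1.trans_le (le_law hP.1 (fun ω => (f ω, g ω)) ω)
      have h3 := h1.trans_le (le_law hP.1 g ω)
      rw [Real.log_div (mul_pos (hQpos ω h0) h3).ne' h2.ne', Real.log_mul (hQpos ω h0).ne' h3.ne',
        Real.logb_div h2.ne' h3.ne']
      simp only [Real.logb]
      ring
  rw [this]
  exact div_nonpos_of_nonpos_of_nonneg key hlog.le

theorem condEntropy_le_logb_card {P : Ω → ℝ} (hP : P ∈ stdSimplex ℝ Ω) (f : Ω → α) (g : Ω → β) :
    condEntropy P f g ≤ Real.logb 2 (Fintype.card α : ℝ) := by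
  have hne : Nonempty Ω := by
    by_contra h
    rw [not_nonempty_iff] at h
    simpa using hP.2
  have hα : (0 : ℝ) < Fintype.card α := by
    have : Nonempty α := hne.map f
    exact_mod_cast Fintype.card_pos
  refine (condEntropy_le_cross hP f g (fun _ _ => (Fintype.card α : ℝ)⁻¹)
    (fun _ _ => by positivity) (fun _ _ => by positivity) fun _ => ?_).trans_eq ?_
  · simp [hα.ne']
  · rw [← Finset.sum_mul, hP.2, Real.logb_inv]
    ring

theorem condEntropy_prod_le {P : Ω → ℝ} (hP : P ∈ stdSimplex ℝ Ω) (f : Ω → α) (g : Ω → β)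
    (h : Ω → γ) : condEntropy P f (fun ω => (g ω, h ω)) ≤ condEntropy P f h := by
  refine (condEntropy_le_cross hP f (fun ω => (g ω, h ω))
    (fun a b => law P (fun ω => (f ω, h ω)) (a, b.2) / law P h b.2)
    (fun _ _ => div_nonneg (law_nonneg hP.1 _ _) (law_nonneg hP.1 _ _)) (fun ω h0 => ?_)
    fun b => ?_).trans_eq (condEntropy_eq_sum P f h).symm
  · have h1 : 0 < P ω := lt_of_le_of_ne (hP.1 ω) (Ne.symm h0)
    exact div_pos (h1.trans_le (le_law hP.1 (fun ω => (f ω, h ω)) ω))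
      (h1.trans_le (le_law hP.1 h ω))
  · rw [← Finset.sum_div]
    have : ∑ a, law P (fun ω => (f ω, h ω)) (a, b.2) = law P h b.2 := by
      classical
      simp only [law, Prod.mk.injEq]
      rw [Finset.sum_comm]
      refine Finset.sum_congr rfl fun ω _ => ?_
      by_cases hb : h ω = b.2 <;> simp [hb]
    rw [this]
    exact div_self_le_one _

/-- Conditioning on more information reduces entropy. -/
theorem condEntropy_le_of_determines {P : Ω → ℝ} (hP : P ∈ stdSimplex ℝ Ω) (f : Ω → α)
    {g : Ω → β} {h : Ω → γ} (hgh : ∀ ω ω', g ω = g ω' → h ω = h ω') :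
    condEntropy P f g ≤ condEntropy P f h := by
  refine le_trans (le_of_eq ?_) (condEntropy_prod_le hP f g h)
  rw [condEntropy_eq hP.1, condEntropy_eq hP.1]
  congr 1 <;> refine entropy_congr fun ω ω' _ _ => ?_ <;> simp only [Prod.mk.injEq]
  · exact ⟨fun e => ⟨e.1, e.2, hgh _ _ e.2⟩, fun e => ⟨e.1, e.2.1⟩⟩
  · exact ⟨fun e => ⟨e, hgh _ _ e⟩, fun e => e.1⟩

theorem entropy_of_subsingleton [Subsingleton α] {P : Ω → ℝ} (hP : P ∈ stdSimplex ℝ Ω)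
    (f : Ω → α) : entropy P f = 0 := by
  rw [entropy_eq_sum, neg_eq_zero]
  refine Finset.sum_eq_zero fun ω _ => ?_
  have : law P f (f ω) = 1 := by
    classical
    simp [law, Subsingleton.elim _ (f ω), hP.2]
  simp [this]

theorem entropy_mono {P : Ω → ℝ} (hP : ∀ ω, 0 ≤ P ω) {f : Ω → α} {g : Ω → β}
    (hfg : ∀ ω ω', f ω = f ω' → g ω = g ω') : entropy P g ≤ entropy P f := by
  have h1 := condEntropy_nonneg hP f g
  rw [condEntropy_eq hP] at h1
  have h2 : entropy P (fun ω => (f ω, g ω)) = entropy P f := entropy_congr fun ω ω' _ _ => by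
    simp only [Prod.mk.injEq]
    exact ⟨fun e => e.1, fun e => ⟨e, hfg _ _ e⟩⟩
  linarith

theorem condEntropy_unit {P : Ω → ℝ} (hP : P ∈ stdSimplex ℝ Ω) (f : Ω → α) :
    condEntropy P f (fun _ => ()) = entropy P f := by
  rw [condEntropy_eq hP.1, entropy_of_subsingleton hP (fun _ => ()), sub_zero]
  exact entropy_congr fun ω ω' _ _ => by simp

theorem entropy_le_logb_card {P : Ω → ℝ} (hP : P ∈ stdSimplex ℝ Ω) (f : Ω → α) :
    entropy P f ≤ Real.logb 2 (Fintype.card α) :=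
  (condEntropy_unit hP f).symm.trans_le (condEntropy_le_logb_card hP f _)

theorem entropy_prod_le {P : Ω → ℝ} (hP : P ∈ stdSimplex ℝ Ω) (f : Ω → α) (g : Ω → β) :
    entropy P (fun ω => (f ω, g ω)) ≤ entropy P f + entropy P g := by
  have h := condEntropy_le_of_determines hP f (g := g) (h := fun _ => ()) fun _ _ _ => rfl
  rw [condEntropy_unit hP, condEntropy_eq hP.1] at h
  linarith

theorem entropy_uniform_injective [Nonempty Ω] {f : Ω → α} (hf : Function.Injective f) :
    entropy (fun _ : Ω => (Fintype.card Ω : ℝ)⁻¹) f = Real.logb 2 (Fintype.card Ω) := by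
  classical
  have h : ∀ ω, law (fun _ : Ω => (Fintype.card Ω : ℝ)⁻¹) f (f ω) = (Fintype.card Ω : ℝ)⁻¹ :=
    fun ω => by simp [law, hf.eq_iff]
  rw [entropy_eq_sum]
  simp [h, Real.logb_inv]

/-- Fano's inequality: if `f` is guessed from `g` by `d`, then `H(f | g) ≤ 1 + P[error] log |α|`. -/
theorem fano [DecidableEq α] {P : Ω → ℝ} (hP : P ∈ stdSimplex ℝ Ω) (f : Ω → α) (g : Ω → β)
    (d : β → α) :
    condEntropy P f g ≤ 1 + (∑ ω, P ω * if d (g ω) = f ω then 0 else 1) *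
      Real.logb 2 (Fintype.card α : ℝ) := by
  have hne : Nonempty Ω := by
    by_contra h
    rw [not_nonempty_iff] at h
    simpa using hP.2
  have hα1 : 1 ≤ Fintype.card α := by
    have : Nonempty α := hne.map f
    exact Fintype.card_pos (α := α)
  have hα : (1 : ℝ) ≤ Fintype.card α := by exact_mod_cast hα1
  set K : ℝ := (Fintype.card α : ℝ) with hK
  have hK0 : 0 < K := by linarith
  refine (condEntropy_le_cross hP f g (fun a b => (if a = d b then 2⁻¹ else 0) + (2 * K)⁻¹)
    (fun _ _ => by positivity) (fun _ _ => by positivity) fun b => ?_).trans ?_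
  · rw [Finset.sum_add_distrib]
    simp only [Finset.sum_ite_eq', Finset.mem_univ, if_true, Finset.sum_const, Finset.card_univ,
      nsmul_eq_mul, ← hK]
    field_simp
    norm_num
  · have h1 : ∀ c : ℝ, 1 + c = ∑ ω, P ω * 1 + c := by simp [hP.2]
    rw [h1, Finset.sum_mul, ← Finset.sum_add_distrib, ← Finset.sum_neg_distrib]
    refine Finset.sum_le_sum fun ω _ => ?_
    rw [mul_assoc, ← mul_add, ← mul_neg]
    refine mul_le_mul_of_nonneg_left ?_ (hP.1 ω)
    by_cases h : f ω = d (g ω)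
    · have h2 : Real.logb 2 2⁻¹ ≤ Real.logb 2 (2⁻¹ + (2 * K)⁻¹) :=
        Real.logb_le_logb_of_le one_lt_two (by norm_num) (le_add_of_nonneg_right (by positivity))
      rw [Real.logb_inv, Real.logb_self_eq_one one_lt_two] at h2
      simp [← h]
      simp at h2
      linarith
    · simp only [if_neg h, if_neg (Ne.symm h), zero_add, Real.logb_inv]
      rw [Real.logb_mul two_ne_zero hK0.ne', Real.logb_self_eq_one one_lt_two]
      linarith

/-- The weights of a pair of independent random variables. -/
def prodWeight (P : Ω → ℝ) (p : ι → ℝ) : Ω × ι → ℝ := fun z => P z.1 * p z.2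

theorem prodWeight_mem_stdSimplex {P : Ω → ℝ} {p : ι → ℝ} (hP : P ∈ stdSimplex ℝ Ω)
    (hp : p ∈ stdSimplex ℝ ι) : prodWeight P p ∈ stdSimplex ℝ (Ω × ι) := by
  refine ⟨fun z => mul_nonneg (hP.1 _) (hp.1 _), ?_⟩
  simp only [prodWeight, Fintype.sum_prod_type, ← Finset.mul_sum, hp.2, mul_one, hP.2]

theorem entropy_prodWeight_fst (P : Ω → ℝ) {p : ι → ℝ} (hp : ∑ i, p i = 1) (f : Ω → α) :
    entropy (prodWeight P p) (fun z => f z.1) = entropy P f := by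
  classical
  have : law (prodWeight P p) (fun z => f z.1) = law P f := by
    funext a
    simp only [law, prodWeight, Fintype.sum_prod_type]
    refine Finset.sum_congr rfl fun ω _ => ?_
    split_ifs
    · rw [← Finset.mul_sum, hp, mul_one]
    · simp
  rw [entropy, entropy, this]

/-- The entropy of an observation `g i` whose kind `i` is chosen independently and is part of the
observation. -/
theorem entropy_prodWeight_sigma {κ : ι → Type*} [∀ i, Fintype (κ i)] {P : Ω → ℝ}
    (hP : P ∈ stdSimplex ℝ Ω) (p : ι → ℝ) (g : ∀ i, Ω → κ i) :
    entropy (prodWeight P p) (fun z => (⟨z.2, g z.2 z.1⟩ : Σ i, κ i)) =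
      (-∑ i, p i * Real.logb 2 (p i)) + ∑ i, p i * entropy P (g i) := by
  classical
  have hl : ∀ ω i, law (prodWeight P p) (fun z => (⟨z.2, g z.2 z.1⟩ : Σ i, κ i)) ⟨i, g i ω⟩ =
      p i * law P (g i) (g i ω) := by
    intro ω i
    simp only [law, prodWeight, Fintype.sum_prod_type, Finset.mul_sum]
    refine Finset.sum_congr rfl fun ω' _ => ?_
    rw [Finset.sum_eq_single i]
    · simp [mul_comm]
    · intro j _ hj
      rw [if_neg]
      intro h
      exact hj (Sigma.mk.inj_iff.1 h).1
    · simp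
  rw [entropy_eq_sum]
  simp only [Fintype.sum_prod_type_right, hl, entropy_eq_sum P, prodWeight]
  rw [← Finset.sum_neg_distrib, ← Finset.sum_neg_distrib, ← Finset.sum_add_distrib]
  refine Finset.sum_congr rfl fun i _ => ?_
  by_cases hi : p i = 0
  · simp [hi]
  · rw [mul_neg, ← neg_add, Finset.mul_sum]
    congr 1
    have : p i * Real.logb 2 (p i) = ∑ ω, P ω * (p i * Real.logb 2 (p i)) := by
      rw [← Finset.sum_mul, hP.2, one_mul]
    rw [this, ← Finset.sum_add_distrib]
    refine Finset.sum_congr rfl fun ω _ => ?_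
    by_cases h0 : P ω = 0
    · simp [h0]
    · have h1 : 0 < P ω := lt_of_le_of_ne (hP.1 ω) (Ne.symm h0)
      rw [Real.logb_mul hi (h1.trans_le (le_law hP.1 (g i) ω)).ne']
      ring

end Calculus

/-! ### The entropy of the leading bits -/

section Prefix

variable {Ω γ γ' : Type*} [Fintype Ω] [Fintype γ] [Fintype γ'] {n : ℕ}

theorem topBits_eq_iff {m : ℕ} {x x' : Input n} :
    topBits m x = topBits m x' ↔ ∀ j : Fin n, j.val < m → x j = x' j := by
  simp [topBits, funext_iff]

theorem topBits_succ_eq_iff {x x' : Input n} (j : Fin n) :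
    topBits (j.val + 1) x = topBits (j.val + 1) x' ↔
      x j = x' j ∧ topBits j.val x = topBits j.val x' := by
  rw [topBits_eq_iff, topBits_eq_iff]
  constructor
  · exact fun h => ⟨h j (Nat.lt_succ_self _), fun k hk => h k (Nat.lt_succ_of_lt hk)⟩
  · rintro ⟨h1, h2⟩ k hk
    rcases Nat.lt_succ_iff_lt_or_eq.1 hk with h | h
    · exact h2 k h
    · rw [Fin.ext h]
      exact h1

theorem topBits_mono {m m' : ℕ} (h : m ≤ m') {x x' : Input n} (hx : topBits m' x = topBits m' x') :
    topBits m x = topBits m x' := by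
  rw [topBits_eq_iff] at hx ⊢
  exact fun j hj => hx j (hj.trans_le h)

/-- The joint entropy `H(W, X^1, …, X^j)`. -/
noncomputable def prefixEntropy (P : Ω → ℝ) (W : Ω → γ) (X : Ω → Input n) (j : ℕ) : ℝ :=
  entropy P (fun ω => (W ω, topBits j (X ω)))

/-- The conditional entropy `H(X^{j+1} | W, X^1, …, X^j)`, as an increment of joint entropies. -/
noncomputable def bitEntropy (P : Ω → ℝ) (W : Ω → γ) (X : Ω → Input n) (j : ℕ) : ℝ :=
  prefixEntropy P W X (j + 1) - prefixEntropy P W X j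

theorem condEntropy_bit {P : Ω → ℝ} (hP : ∀ ω, 0 ≤ P ω) (W : Ω → γ) (X : Ω → Input n)
    (j : Fin n) :
    condEntropy P (fun ω => X ω j) (fun ω => (W ω, topBits j.val (X ω))) =
      bitEntropy P W X j.val := by
  rw [condEntropy_eq hP, bitEntropy, prefixEntropy, prefixEntropy]
  congr 1
  refine entropy_congr fun ω ω' _ _ => ?_
  simp only [Prod.mk.injEq, topBits_succ_eq_iff]
  tauto

theorem bitEntropy_nonneg {P : Ω → ℝ} (hP : ∀ ω, 0 ≤ P ω) (W : Ω → γ) (X : Ω → Input n) (j : ℕ) :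
    0 ≤ bitEntropy P W X j := by
  refine sub_nonneg.2 (entropy_mono hP fun ω ω' h => ?_)
  simp only [Prod.mk.injEq] at h ⊢
  exact ⟨h.1, topBits_mono (Nat.le_succ j) h.2⟩

theorem bitEntropy_le_one {P : Ω → ℝ} (hP : P ∈ stdSimplex ℝ Ω) (W : Ω → γ) (X : Ω → Input n)
    {j : ℕ} (hj : j < n) : bitEntropy P W X j ≤ 1 := by
  have h := condEntropy_le_logb_card hP (fun ω => X ω ⟨j, hj⟩) (fun ω => (W ω, topBits j (X ω)))
  rw [condEntropy_bit hP.1 W X ⟨j, hj⟩] at h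
  simpa using h

theorem bitEntropy_le_of_determines {P : Ω → ℝ} (hP : P ∈ stdSimplex ℝ Ω) {W : Ω → γ}
    {W' : Ω → γ'} (h : ∀ ω ω', W ω = W ω' → W' ω = W' ω') (X : Ω → Input n) {j : ℕ} (hj : j < n) :
    bitEntropy P W X j ≤ bitEntropy P W' X j := by
  rw [← condEntropy_bit hP.1 W X ⟨j, hj⟩, ← condEntropy_bit hP.1 W' X ⟨j, hj⟩]
  refine condEntropy_le_of_determines hP _ fun ω ω' e => ?_
  simp only [Prod.mk.injEq] at e ⊢
  exact ⟨h _ _ e.1, e.2⟩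

theorem prefixEntropy_eq_add_sum (P : Ω → ℝ) (W : Ω → γ) (X : Ω → Input n) (m : ℕ) :
    prefixEntropy P W X m = prefixEntropy P W X 0 + ∑ j ∈ Finset.range m, bitEntropy P W X j := by
  rw [Finset.sum_congr rfl fun j _ => bitEntropy.eq_1 P W X j, Finset.sum_range_sub]
  ring

theorem prefixEntropy_zero (P : Ω → ℝ) (W : Ω → γ) (X : Ω → Input n) :
    prefixEntropy P W X 0 = entropy P W :=
  entropy_congr fun ω ω' _ _ => by simp [topBits_eq_iff]

theorem prefixEntropy_unit (P : Ω → ℝ) (X : Ω → Input n) (j : ℕ) :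
    prefixEntropy P (fun _ => ()) X j = entropy P (fun ω => topBits j (X ω)) :=
  entropy_congr fun ω ω' _ _ => by simp

end Prefix

/-! ### Averaging over the fading state -/

section Tail

variable {n : ℕ}

theorem tail_nonneg {p : Fin (n + 1) → ℝ} (hp : ∀ i, 0 ≤ p i) (j : ℕ) : 0 ≤ tail p j :=
  Finset.sum_nonneg fun i _ => by split_ifs <;> simp [hp]

theorem tail_antitone {p : Fin (n + 1) → ℝ} (hp : ∀ i, 0 ≤ p i) : Antitone (tail p) := by
  intro j k hjk
  refine Finset.sum_le_sum fun i _ => ?_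
  by_cases h : k ≤ i.val
  · simp [h, hjk.trans h]
  · simp only [h, if_false]
    split_ifs <;> simp [hp]

/-- Summation by parts: the mean of `E(M₂)` in terms of the increments of `E` and the tail of
`M₂`. -/
theorem sum_mul_eq_tail {p : Fin (n + 1) → ℝ} (hp : ∑ i, p i = 1) (E : ℕ → ℝ) :
    ∑ i : Fin (n + 1), p i * E i.val =
      E 0 + ∑ j ∈ Finset.range n, tail p (j + 1) * (E (j + 1) - E j) := by
  have h : ∀ i : Fin (n + 1), E i.val =
      E 0 + ∑ j ∈ Finset.range n, if j + 1 ≤ i.val then E (j + 1) - E j else 0 := by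
    intro i
    rw [← Finset.sum_filter]
    have : (Finset.range n).filter (fun j => j + 1 ≤ i.val) = Finset.range i.val := by
      ext j
      have := i.2
      simp only [Finset.mem_filter, Finset.mem_range]
      omega
    rw [this, Finset.sum_range_sub]
    ring
  rw [Finset.sum_congr rfl fun i _ => by rw [h i, mul_add], Finset.sum_add_distrib,
    ← Finset.sum_mul, hp, one_mul]
  simp only [tail, Finset.mul_sum, Finset.sum_mul]
  rw [Finset.sum_comm]
  simp only [mul_ite, mul_zero, ite_mul, zero_mul]

/-- `F(μ)` as a sum over all bits, indexed from `0`. -/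
theorem optValue_eq (m₁ : ℕ) (hmn : m₁ ≤ n) (p : Fin (n + 1) → ℝ) (μ : ℝ) :
    optValue m₁ p μ = ∑ j ∈ Finset.range n,
      if j < m₁ then max 1 (μ * tail p (j + 1)) else μ * tail p (j + 1) := by
  have h1 : ∀ (a b : ℕ) (f : ℕ → ℝ),
      ∑ j ∈ Finset.Icc (a + 1) b, f j = ∑ j ∈ Finset.Ico a b, f (j + 1) := fun a b f => by
    rw [Finset.sum_Ico_add' f a b 1]
    rfl
  have h0 := h1 0
  rw [zero_add] at h0
  rw [optValue, h0, h1, Finset.mul_sum, Finset.range_eq_Ico,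
    ← Finset.sum_Ico_consecutive _ (Nat.zero_le m₁) hmn]
  congr 1 <;> refine Finset.sum_congr rfl fun j hj => ?_ <;> rw [Finset.mem_Ico] at hj
  · rw [if_pos hj.2]
  · rw [if_neg hj.1.not_gt]

end Tail

/-! ### The single-letter optimization problem -/

section SingleLetter

variable {n : ℕ} {V : Type} [Fintype V] {α : Type*} [Fintype α]

theorem withFading_eq_law (p : Fin (n + 1) → ℝ) (P : V × Input n → ℝ) :
    withFading p P = law (prodWeight P p) (fun z => (z.1.1, z.1.2, z.2)) := by
  classical
  funext ω
  rw [law, Finset.sum_eq_single ((ω.1, ω.2.1), ω.2.2)]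
  · simp [withFading, prodWeight]
  · rintro ⟨⟨v, x⟩, i⟩ _ h
    rw [if_neg]
    rintro rfl
    exact h rfl
  · simp

theorem withFading_mem_stdSimplex {p : Fin (n + 1) → ℝ} (hp : p ∈ stdSimplex ℝ (Fin (n + 1)))
    {P : V × Input n → ℝ} (hP : P ∈ stdSimplex ℝ (V × Input n)) :
    withFading p P ∈ stdSimplex ℝ (V × Input n × Fin (n + 1)) := by
  rw [withFading_eq_law]
  exact law_mem_stdSimplex (prodWeight_mem_stdSimplex hP hp) _

theorem entropy_withFading {p : Fin (n + 1) → ℝ} (hp : p ∈ stdSimplex ℝ (Fin (n + 1)))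
    (P : V × Input n → ℝ) (f : V × Input n → α) :
    entropy (withFading p P) (fun ω => f (ω.1, ω.2.1)) = entropy P f := by
  rw [withFading_eq_law, entropy_law]
  exact entropy_prodWeight_fst P hp.2 f

theorem entropy_withFading_rvY₂ (p : Fin (n + 1) → ℝ)
    {P : V × Input n → ℝ} (hP : P ∈ stdSimplex ℝ (V × Input n)) (f : V × Input n → α) :
    entropy (withFading p P) (fun ω => (f (ω.1, ω.2.1), rvY₂ ω)) =
      (-∑ i, p i * Real.logb 2 (p i)) +
        ∑ i : Fin (n + 1), p i * prefixEntropy P f Prod.snd i.val := by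
  rw [withFading_eq_law, entropy_law]
  refine Eq.trans (entropy_congr fun z z' _ _ => ?_) (entropy_prodWeight_sigma hP p
    (fun (i : Fin (n + 1)) z => (f z, topBits i.val z.2)))
  obtain ⟨⟨v, x⟩, i⟩ := z
  obtain ⟨⟨v', x'⟩, i'⟩ := z'
  simp only [rvY₂, fadedOutput, Prod.mk.injEq]
  constructor
  · rintro ⟨h1, h2⟩
    obtain ⟨rfl, h3⟩ := Sigma.mk.inj_iff.1 h2
    rw [h1, eq_of_heq h3]
  · intro h2
    obtain ⟨rfl, h3⟩ := Sigma.mk.inj_iff.1 h2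
    simp only [heq_eq_eq, Prod.mk.injEq] at h3
    rw [h3.1, h3.2]
    exact ⟨rfl, rfl⟩

theorem entropy_rvY₂ (p : Fin (n + 1) → ℝ)
    {P : V × Input n → ℝ} (hP : P ∈ stdSimplex ℝ (V × Input n)) :
    entropy (withFading p P) rvY₂ = (-∑ i, p i * Real.logb 2 (p i)) +
        ∑ i : Fin (n + 1), p i * prefixEntropy P (fun _ => ()) Prod.snd i.val := by
  rw [← entropy_withFading_rvY₂ p hP fun _ => ()]
  exact entropy_congr fun ω ω' _ _ => by simp

/-- `I(V; Y₂)` for an auxiliary variable that is a function of the sample point. -/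
theorem mutualInfo_rvY₂ {p : Fin (n + 1) → ℝ} (hp : p ∈ stdSimplex ℝ (Fin (n + 1)))
    {P : V × Input n → ℝ} (hP : P ∈ stdSimplex ℝ (V × Input n)) (f : V × Input n → α) :
    mutualInfo (withFading p P) (fun ω => f (ω.1, ω.2.1)) rvY₂ =
      ∑ j ∈ Finset.range n, tail p (j + 1) *
        (bitEntropy P (fun _ => ()) Prod.snd j - bitEntropy P f Prod.snd j) := by
  rw [mutualInfo_eq (withFading_mem_stdSimplex hp hP).1, entropy_rvY₂ p hP,
    entropy_withFading_rvY₂ p hP, sum_mul_eq_tail hp.2, sum_mul_eq_tail hp.2, prefixEntropy_zero,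
    prefixEntropy_zero, entropy_of_subsingleton hP, entropy_withFading hp]
  simp only [mul_sub, Finset.sum_sub_distrib, bitEntropy]
  ring

theorem condMutualInfo_rvY₁ {p : Fin (n + 1) → ℝ} (hp : p ∈ stdSimplex ℝ (Fin (n + 1)))
    {P : V × Input n → ℝ} (hP : P ∈ stdSimplex ℝ (V × Input n)) (m₁ : ℕ) :
    condMutualInfo (withFading p P) rvX (rvY₁ m₁) rvV =
      ∑ j ∈ Finset.range m₁, bitEntropy P Prod.fst Prod.snd j := by
  rw [condMutualInfo_eq_of_determines (withFading_mem_stdSimplex hp hP).1 _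
    (fun ω ω' h => by simp only [rvX, rvY₁] at h ⊢; rw [h]),
    ← sub_eq_iff_eq_add'.2 (prefixEntropy_eq_add_sum P Prod.fst Prod.snd m₁), prefixEntropy_zero]
  congr 1
  · refine Eq.trans ?_ (entropy_withFading hp P fun z => (z.1, topBits m₁ z.2))
    exact entropy_congr fun ω ω' _ _ => by simp [rvY₁, rvV, and_comm]
  · exact entropy_withFading hp P Prod.fst

/-- Bit by bit, the objective is the sum of the contributions of `H(X^j | X^1, …, X^{j-1})` and
`H(X^j | V, X^1, …, X^{j-1})`. -/
theorem objective_eq {p : Fin (n + 1) → ℝ} (hp : p ∈ stdSimplex ℝ (Fin (n + 1)))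
    {P : V × Input n → ℝ} (hP : P ∈ stdSimplex ℝ (V × Input n)) {m₁ : ℕ} (hmn : m₁ ≤ n) (μ : ℝ) :
    objective m₁ p μ P = ∑ j ∈ Finset.range n,
      ((if j < m₁ then bitEntropy P Prod.fst Prod.snd j else 0) + μ * tail p (j + 1) *
        (bitEntropy P (fun _ => ()) Prod.snd j - bitEntropy P Prod.fst Prod.snd j)) := by
  rw [objective, condMutualInfo_rvY₁ hp hP]
  have h := mutualInfo_rvY₂ hp hP Prod.fst
  change mutualInfo (withFading p P) rvV rvY₂ = _ at h
  rw [h, Finset.sum_add_distrib, Finset.mul_sum, ← Finset.sum_filter]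
  have : (Finset.range n).filter (fun j => j < m₁) = Finset.range m₁ := by
    ext j
    simp only [Finset.mem_filter, Finset.mem_range]
    omega
  simp only [this, mul_assoc]

/-- The maximum of the contribution of one bit over `0 ≤ b ≤ a ≤ 1`; here `q` says that receiver 1
sees the bit. -/
theorem bit_contribution_le {a b c : ℝ} (hb : 0 ≤ b) (hba : b ≤ a) (ha : a ≤ 1) (hc : 0 ≤ c)
    (q : Prop) [Decidable q] :
    (if q then b else 0) + c * (a - b) ≤ if q then max 1 c else c := by
  split_ifs
  · rcases le_total 1 c with h | h
    · rw [max_eq_right h]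
      nlinarith
    · rw [max_eq_left h]
      nlinarith
  · nlinarith

theorem bitEntropy_bounds {P : V × Input n → ℝ} (hP : P ∈ stdSimplex ℝ (V × Input n))
    {j : ℕ} (hj : j < n) : 0 ≤ bitEntropy P Prod.fst Prod.snd j ∧
      bitEntropy P Prod.fst Prod.snd j ≤ bitEntropy P (fun _ => ()) Prod.snd j ∧
      bitEntropy P (fun _ => ()) Prod.snd j ≤ 1 :=
  ⟨bitEntropy_nonneg hP.1 _ _ _, bitEntropy_le_of_determines hP (fun _ _ _ => rfl) _ hj,
    bitEntropy_le_one hP _ _ hj⟩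

theorem objective_le_optValue {p : Fin (n + 1) → ℝ} (hp : p ∈ stdSimplex ℝ (Fin (n + 1)))
    {P : V × Input n → ℝ} (hP : P ∈ stdSimplex ℝ (V × Input n)) {m₁ : ℕ} (hmn : m₁ ≤ n)
    {μ : ℝ} (hμ : 0 ≤ μ) : objective m₁ p μ P ≤ optValue m₁ p μ := by
  rw [objective_eq hp hP hmn, optValue_eq m₁ hmn]
  refine Finset.sum_le_sum fun j hj => ?_
  obtain ⟨h1, h2, h3⟩ := bitEntropy_bounds hP (Finset.mem_range.1 hj)
  exact bit_contribution_le h1 h2 h3 (mul_nonneg hμ (tail_nonneg hp.1 _)) _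

theorem bit_contribution_eq {p : Fin (n + 1) → ℝ} (hp : p ∈ stdSimplex ℝ (Fin (n + 1)))
    {P : V × Input n → ℝ} (hP : P ∈ stdSimplex ℝ (V × Input n)) {m₁ : ℕ} (hmn : m₁ ≤ n)
    {μ : ℝ} (hμ : 0 ≤ μ) (h : objective m₁ p μ P = optValue m₁ p μ) {j : ℕ} (hj : j < n) :
    (if j < m₁ then bitEntropy P Prod.fst Prod.snd j else 0) + μ * tail p (j + 1) *
        (bitEntropy P (fun _ => ()) Prod.snd j - bitEntropy P Prod.fst Prod.snd j) =
      if j < m₁ then max 1 (μ * tail p (j + 1)) else μ * tail p (j + 1) := by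
  rw [objective_eq hp hP hmn, optValue_eq m₁ hmn] at h
  refine (Finset.sum_eq_sum_iff_of_le fun j hj => ?_).1 h j (Finset.mem_range.2 hj)
  obtain ⟨h1, h2, h3⟩ := bitEntropy_bounds hP (Finset.mem_range.1 hj)
  exact bit_contribution_le h1 h2 h3 (mul_nonneg hμ (tail_nonneg hp.1 _)) _

theorem condEntropy_withFading_bit {p : Fin (n + 1) → ℝ} (hp : p ∈ stdSimplex ℝ (Fin (n + 1)))
    {P : V × Input n → ℝ} (hP : P ∈ stdSimplex ℝ (V × Input n)) (j : Fin n) :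
    condEntropy (withFading p P) (fun ω => rvX ω j) (fun ω => topBits j.val (rvX ω)) =
      bitEntropy P (fun _ => ()) Prod.snd j.val := by
  rw [← condEntropy_bit hP.1, condEntropy_eq (withFading_mem_stdSimplex hp hP).1,
    condEntropy_eq hP.1]
  congr 1
  · refine (entropy_withFading hp P fun z => (z.2 j, topBits j.val z.2)).trans ?_
    exact entropy_congr fun ω ω' _ _ => by simp
  · refine (entropy_withFading hp P fun z => topBits j.val z.2).trans ?_
    exact entropy_congr fun ω ω' _ _ => by simp

theorem condEntropy_withFading_rvV_bit {p : Fin (n + 1) → ℝ}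
    (hp : p ∈ stdSimplex ℝ (Fin (n + 1)))
    {P : V × Input n → ℝ} (hP : P ∈ stdSimplex ℝ (V × Input n)) (j : Fin n) :
    condEntropy (withFading p P) (fun ω => rvX ω j)
        (fun ω => (rvV ω, topBits j.val (rvX ω))) = bitEntropy P Prod.fst Prod.snd j.val := by
  rw [← condEntropy_bit hP.1, condEntropy_eq (withFading_mem_stdSimplex hp hP).1,
    condEntropy_eq hP.1]
  congr 1
  · exact entropy_withFading hp P fun z => (z.2 j, z.1, topBits j.val z.2)
  · exact entropy_withFading hp P fun z => (z.1, topBits j.val z.2)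

/-- If `V` and the preceding bits determine each of the first `j + 1` bits, `V` alone determines
bit `j + 1`. -/
theorem condEntropy_withFading_rvV_eq_zero {p : Fin (n + 1) → ℝ}
    (hp : p ∈ stdSimplex ℝ (Fin (n + 1)))
    {P : V × Input n → ℝ} (hP : P ∈ stdSimplex ℝ (V × Input n)) (j : Fin n)
    (h : ∀ k ≤ j.val, bitEntropy P Prod.fst Prod.snd k = 0) :
    condEntropy (withFading p P) (fun ω => rvX ω j) rvV = 0 := by
  have hW := withFading_mem_stdSimplex hp hP
  refine le_antisymm ?_ (condEntropy_nonneg hW.1 _ _)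
  have h1 : prefixEntropy P Prod.fst Prod.snd (j.val + 1) = entropy P Prod.fst := by
    rw [prefixEntropy_eq_add_sum, prefixEntropy_zero,
      Finset.sum_eq_zero fun k hk => h k (Nat.lt_succ_iff.1 (Finset.mem_range.1 hk)), add_zero]
  rw [condEntropy_eq hW.1, sub_nonpos]
  refine (entropy_withFading hp P fun z => (z.2 j, z.1)).trans_le ?_
  refine le_trans (entropy_mono hP.1 fun z z' hz => ?_)
    (h1.trans (entropy_withFading hp P Prod.fst).symm).le
  simp only [Prod.mk.injEq, topBits_succ_eq_iff] at hz ⊢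
  exact ⟨hz.2.1, hz.1⟩

/-- The entropies of the bits at an optimum. -/
theorem optimality_conditions {p : Fin (n + 1) → ℝ} (hp : p ∈ stdSimplex ℝ (Fin (n + 1)))
    {P : V × Input n → ℝ} (hP : P ∈ stdSimplex ℝ (V × Input n)) {m₁ : ℕ} (hmn : m₁ ≤ n)
    {μ : ℝ} (hμ : 0 ≤ μ) (h : objective m₁ p μ P = optValue m₁ p μ) {j : ℕ} (hj : j < n) :
    (j < m₁ ∨ 0 < μ * tail p (j + 1) → bitEntropy P (fun _ => ()) Prod.snd j = 1) ∧
    (j < m₁ → 1 < μ * tail p (j + 1) → bitEntropy P Prod.fst Prod.snd j = 0) ∧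
    (j < m₁ → μ * tail p (j + 1) < 1 → bitEntropy P Prod.fst Prod.snd j = 1) ∧
    (m₁ ≤ j → 0 < μ * tail p (j + 1) → bitEntropy P Prod.fst Prod.snd j = 0) := by
  have e := bit_contribution_eq hp hP hmn hμ h hj
  obtain ⟨hb, hba, ha⟩ := bitEntropy_bounds hP hj
  have hc : 0 ≤ μ * tail p (j + 1) := mul_nonneg hμ (tail_nonneg hp.1 _)
  revert e hb hba ha hc
  generalize bitEntropy P Prod.fst Prod.snd j = b
  generalize bitEntropy P (fun _ => ()) Prod.snd j = a
  generalize μ * tail p (j + 1) = c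
  intro e hb hba ha hc
  rcases lt_or_ge j m₁ with hjm | hjm
  · simp only [hjm, if_true] at e
    refine ⟨fun _ => ?_, fun _ h1 => ?_, fun _ h1 => ?_, fun h2 => absurd hjm h2.not_gt⟩
    · rcases le_total 1 c with h1 | h1
      · rw [max_eq_right h1] at e
        nlinarith
      · rw [max_eq_left h1] at e
        nlinarith
    · rw [max_eq_right h1.le] at e
      nlinarith
    · rw [max_eq_left h1.le] at e
      nlinarith
  · simp only [hjm.not_gt, if_false, zero_add] at e
    refine ⟨fun h1 => ?_, fun h1 => absurd h1 hjm.not_gt, fun h1 => absurd h1 hjm.not_gt,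
      fun _ h1 => ?_⟩
    · have h1 := h1.resolve_left hjm.not_gt
      nlinarith
    · nlinarith

end SingleLetter

/-! ### Independent uniform bits -/

section Uniform

variable {n : ℕ} {α : Type*} [Fintype α]

/-- The uniform weights on the inputs. -/
noncomputable def uniformInput (n : ℕ) : Input n → ℝ := fun _ => ((2 : ℝ) ^ n)⁻¹

theorem uniformInput_mem_stdSimplex : uniformInput n ∈ stdSimplex ℝ (Input n) := by
  refine ⟨fun _ => by unfold uniformInput; positivity, ?_⟩
  simp [uniformInput]

theorem card_filter_fin_Ico {a b : ℕ} (hb : b ≤ n) :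
    (Finset.univ.filter fun j : Fin n => a ≤ j.val ∧ j.val < b).card = b - a := by
  rw [← Nat.card_Ico, ← Finset.card_map Fin.valEmbedding]
  congr 1
  ext k
  simp only [Finset.mem_map, Finset.mem_filter, Finset.mem_univ, true_and, Fin.valEmbedding_apply,
    Finset.mem_Ico]
  exact ⟨by rintro ⟨j, h, rfl⟩; exact h, fun h => ⟨⟨k, h.2.trans_le hb⟩, h, rfl⟩⟩

theorem entropy_restrict_le {Ω : Type*} [Fintype Ω] {P : Ω → ℝ} (hP : P ∈ stdSimplex ℝ Ω)
    (X : Ω → Input n) (s : Fin n → Prop) [DecidablePred s] :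
    entropy P (fun ω (j : {j : Fin n // s j}) => X ω j.1) ≤ (Finset.univ.filter s).card := by
  refine (entropy_le_logb_card hP _).trans_eq ?_
  rw [Fintype.card_fun, Fintype.card_bool, Fintype.card_subtype]
  push_cast
  rw [Real.logb_pow, Real.logb_self_eq_one one_lt_two, mul_one]

/-- An observation of uniform bits that amounts to the bits in `s` has entropy `|s|`: it is at most
`|s|`, the other bits have at most the rest, and all together have `n`. -/
theorem entropy_uniformInput (s : Fin n → Prop) [DecidablePred s] (f : Input n → α)
    (h : ∀ x x', f x = f x' ↔ ∀ j, s j → x j = x' j) :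
    entropy (uniformInput n) f = (Finset.univ.filter s).card := by
  have hP := uniformInput_mem_stdSimplex (n := n)
  have e1 : entropy (uniformInput n) f =
      entropy (uniformInput n) (fun x (j : {j : Fin n // s j}) => x j.1) :=
    entropy_congr fun x x' _ _ => by simp [h, funext_iff]
  have e2 : entropy (uniformInput n) (fun x => x) = n := by
    have := entropy_uniform_injective (f := fun x : Input n => x) Function.injective_id
    have hu : (fun _ => (Fintype.card (Input n) : ℝ)⁻¹) = uniformInput n := by
      funext x
      simp [uniformInput]
    rw [hu] at this
    simpa [Real.logb_pow] using this
  have e3 : entropy (uniformInput n) (fun x => x) ≤ entropy (uniformInput n)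
      (fun x => (fun j : {j : Fin n // s j} => x j.1, fun j : {j : Fin n // ¬ s j} => x j.1)) := by
    refine entropy_mono hP.1 fun x x' e => funext fun j => ?_
    simp only [Prod.mk.injEq, funext_iff, Subtype.forall] at e
    by_cases hj : s j
    · exact e.1 j hj
    · exact e.2 j hj
  have e4 := entropy_prod_le hP (fun x (j : {j : Fin n // s j}) => x j.1)
    (fun x (j : {j : Fin n // ¬ s j}) => x j.1)
  have e5 := entropy_restrict_le hP (fun x => x) s
  have e6 := entropy_restrict_le hP (fun x => x) (fun j => ¬ s j)
  have e7 : ((Finset.univ.filter s).card : ℝ) + (Finset.univ.filter fun j => ¬ s j).card = n := by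
    exact_mod_cast (Finset.card_filter_add_card_filter_not s).trans (Finset.card_fin n)
  rw [e1]
  linarith

theorem vBits_eq_iff {m₁ i₀ : ℕ} {x x' : Input n} :
    vBits m₁ i₀ x = vBits m₁ i₀ x' ↔ ∀ j : Fin n, (j.val < i₀ ∨ m₁ ≤ j.val) → x j = x' j := by
  simp [vBits, funext_iff]

theorem uBits_eq_iff {m₁ i₀ : ℕ} {x x' : Input n} :
    uBits m₁ i₀ x = uBits m₁ i₀ x' ↔ ∀ j : Fin n, i₀ ≤ j.val ∧ j.val < m₁ → x j = x' j := by
  simp [uBits, funext_iff]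

theorem bitLaw_eq_law (m₁ i₀ : ℕ) :
    bitLaw n m₁ i₀ = law (uniformInput n) (fun x => (vBits m₁ i₀ x, x)) := by
  classical
  funext z
  rw [law, Finset.sum_eq_single z.2]
  · simp only [bitLaw, uniformInput, Prod.ext_iff, and_true, eq_comm]
  · intro x _ hx
    rw [if_neg]
    rintro rfl
    exact hx rfl
  · simp

theorem bitLaw_mem_stdSimplex (m₁ i₀ : ℕ) :
    bitLaw n m₁ i₀ ∈ stdSimplex ℝ (VBits n m₁ i₀ × Input n) := by
  rw [bitLaw_eq_law]
  exact law_mem_stdSimplex uniformInput_mem_stdSimplex _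

theorem entropy_bitLaw (m₁ i₀ : ℕ) (f : VBits n m₁ i₀ × Input n → α) :
    entropy (bitLaw n m₁ i₀) f = entropy (uniformInput n) (fun x => f (vBits m₁ i₀ x, x)) := by
  rw [bitLaw_eq_law, entropy_law]

theorem bitEntropy_law {Ω Ω' γ : Type*} [Fintype Ω] [Fintype Ω'] [Fintype γ] (P : Ω → ℝ)
    (φ : Ω → Ω') (W : Ω' → γ) (X : Ω' → Input n) (j : ℕ) :
    bitEntropy (law P φ) W X j = bitEntropy P (fun ω => W (φ ω)) (fun ω => X (φ ω)) j := by
  rw [bitEntropy, bitEntropy, prefixEntropy, prefixEntropy, entropy_law, entropy_law]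
  rfl

theorem bitEntropy_uniformInput {j : ℕ} (hj : j < n) :
    bitEntropy (uniformInput n) (fun _ => ()) (fun x => x) j = 1 := by
  have h : ∀ k ≤ n, prefixEntropy (uniformInput n) (fun _ => ()) (fun x => x) k = k := by
    intro k hk
    rw [prefixEntropy_unit, entropy_uniformInput (fun j => 0 ≤ j.val ∧ j.val < k),
      card_filter_fin_Ico hk, Nat.sub_zero]
    exact fun x x' => by simp [topBits_eq_iff]
  rw [bitEntropy, h _ hj, h _ hj.le]
  push_cast
  ring

/-- Given the bits in `s`, the preceding bits tell nothing about a uniform bit outside `s`. -/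
theorem bitEntropy_uniformInput_of_iff (s : ℕ → Prop) [DecidablePred s] (W : Input n → α)
    (h : ∀ x x', W x = W x' ↔ ∀ j : Fin n, s j.val → x j = x' j) {j : ℕ} (hj : j < n) :
    bitEntropy (uniformInput n) W (fun x => x) j = if s j then 0 else 1 := by
  have e : ∀ k, prefixEntropy (uniformInput n) W (fun x => x) k =
      (Finset.univ.filter fun j : Fin n => s j.val ∨ j.val < k).card := by
    intro k
    refine entropy_uniformInput _ _ fun x x' => ?_
    simp only [Prod.mk.injEq, h, topBits_eq_iff]
    exact ⟨fun h j => Or.rec (h.1 j) (h.2 j), fun h => ⟨fun j hj => h j (Or.inl hj),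
      fun j hj => h j (Or.inr hj)⟩⟩
  rw [bitEntropy, e, e]
  by_cases hs : s j
  · rw [if_pos hs, sub_eq_zero]
    congr 2
    ext k
    simp only [Finset.mem_filter, Finset.mem_univ, true_and, Nat.lt_succ_iff_lt_or_eq]
    constructor
    · rintro (h | h | h)
      · exact Or.inl h
      · exact Or.inr h
      · exact Or.inl (h ▸ hs)
    · tauto
  · rw [if_neg hs]
    have : (Finset.univ.filter fun k : Fin n => s k.val ∨ k.val < j + 1) =
        insert ⟨j, hj⟩ (Finset.univ.filter fun k : Fin n => s k.val ∨ k.val < j) := by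
      ext k
      simp only [Finset.mem_filter, Finset.mem_univ, true_and, Finset.mem_insert, Fin.ext_iff,
        Nat.lt_succ_iff_lt_or_eq]
      tauto
    rw [this, Finset.card_insert_of_notMem (by simp [hs])]
    push_cast
    ring

end Uniform

/-! ### The rates of the bit assignments -/

section BitAssignment

variable {n m₁ i₀ : ℕ} {p : Fin (n + 1) → ℝ}

theorem rate₂_eq (hi : i₀ ≤ m₁) (hp : p ∈ stdSimplex ℝ (Fin (n + 1))) :
    rate₂ m₁ p i₀ =
      ∑ j ∈ Finset.range n, tail p (j + 1) * if j < i₀ ∨ m₁ ≤ j then 1 else 0 := by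
  rw [rate₂, sum_mul_eq_tail hp.2 fun i => ((min i i₀ + (i - m₁) : ℕ) : ℝ)]
  simp only [Nat.zero_min, Nat.zero_sub, add_zero, Nat.cast_zero, zero_add]
  refine Finset.sum_congr rfl fun j _ => ?_
  congr 1
  split_ifs with h
  · have : min (j + 1) i₀ + (j + 1 - m₁) = min j i₀ + (j - m₁) + 1 := by omega
    rw [this]
    push_cast
    ring
  · have : min (j + 1) i₀ + (j + 1 - m₁) = min j i₀ + (j - m₁) := by omega
    rw [this, sub_self]

theorem rate₂_nonneg (hp : p ∈ stdSimplex ℝ (Fin (n + 1))) (m₁ i₀ : ℕ) : 0 ≤ rate₂ m₁ p i₀ :=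
  Finset.sum_nonneg fun i _ => mul_nonneg (hp.1 i) (Nat.cast_nonneg _)

theorem rate₂_mono (hp : p ∈ stdSimplex ℝ (Fin (n + 1))) (m₁ : ℕ) : Monotone (rate₂ m₁ p) := by
  intro i k hik
  refine Finset.sum_le_sum fun j _ => mul_le_mul_of_nonneg_left ?_ (hp.1 j)
  exact_mod_cast Nat.add_le_add_right (min_le_min_left _ hik) _

theorem bitEntropy_bitLaw_unit {j : ℕ} (hj : j < n) :
    bitEntropy (bitLaw n m₁ i₀) (fun _ => ()) Prod.snd j = 1 := by
  rw [bitLaw_eq_law, bitEntropy_law]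
  exact bitEntropy_uniformInput hj

theorem bitEntropy_bitLaw {j : ℕ} (hj : j < n) :
    bitEntropy (bitLaw n m₁ i₀) Prod.fst Prod.snd j = if j < i₀ ∨ m₁ ≤ j then 0 else 1 := by
  rw [bitLaw_eq_law, bitEntropy_law]
  exact bitEntropy_uniformInput_of_iff (fun j => j < i₀ ∨ m₁ ≤ j) _ (fun x x' => vBits_eq_iff) hj

theorem sum_range_threshold (hi : i₀ ≤ m₁) :
    ∑ j ∈ Finset.range m₁, (if j < i₀ ∨ m₁ ≤ j then (0 : ℝ) else 1) = (m₁ : ℝ) - i₀ := by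
  rw [← Finset.sum_range_add_sum_Ico _ hi, Finset.sum_eq_zero, Finset.sum_congr rfl (g := fun _ => 1)]
  · simp [Nat.cast_sub hi]
  · intro j hj
    rw [Finset.mem_Ico] at hj
    rw [if_neg (by omega)]
  · intro j hj
    rw [if_pos (Or.inl (Finset.mem_range.1 hj))]

theorem condMutualInfo_bitLaw (hi : i₀ ≤ m₁) (hmn : m₁ ≤ n)
    (hp : p ∈ stdSimplex ℝ (Fin (n + 1))) :
    condMutualInfo (withFading p (bitLaw n m₁ i₀)) rvX (rvY₁ m₁) rvV = (m₁ : ℝ) - i₀ := by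
  rw [condMutualInfo_rvY₁ hp (bitLaw_mem_stdSimplex m₁ i₀), ← sum_range_threshold hi]
  exact Finset.sum_congr rfl fun j hj =>
    bitEntropy_bitLaw ((Finset.mem_range.1 hj).trans_le hmn)

theorem mutualInfo_bitLaw (hi : i₀ ≤ m₁) (hp : p ∈ stdSimplex ℝ (Fin (n + 1))) :
    mutualInfo (withFading p (bitLaw n m₁ i₀)) rvV rvY₂ = rate₂ m₁ p i₀ := by
  rw [rate₂_eq hi hp]
  refine (mutualInfo_rvY₂ hp (bitLaw_mem_stdSimplex m₁ i₀) Prod.fst).trans ?_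
  refine Finset.sum_congr rfl fun j hj => ?_
  rw [bitEntropy_bitLaw (Finset.mem_range.1 hj), bitEntropy_bitLaw_unit (Finset.mem_range.1 hj)]
  split_ifs <;> simp

theorem mutualInfo_uBits_rvV (hp : p ∈ stdSimplex ℝ (Fin (n + 1))) :
    mutualInfo (withFading p (bitLaw n m₁ i₀)) (fun ω => uBits m₁ i₀ (rvX ω)) rvV = 0 := by
  rw [mutualInfo_eq (withFading_mem_stdSimplex hp (bitLaw_mem_stdSimplex m₁ i₀)).1]
  have e1 : entropy (withFading p (bitLaw n m₁ i₀)) (fun ω => uBits m₁ i₀ (rvX ω)) =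
      (Finset.univ.filter fun j : Fin n => i₀ ≤ j.val ∧ j.val < m₁).card :=
    (entropy_withFading hp _ fun z => uBits m₁ i₀ z.2).trans
      ((entropy_bitLaw _ _ _).trans (entropy_uniformInput _ _ fun _ _ => uBits_eq_iff))
  have e2 : entropy (withFading p (bitLaw n m₁ i₀)) rvV =
      (Finset.univ.filter fun j : Fin n => ¬ (i₀ ≤ j.val ∧ j.val < m₁)).card :=
    (entropy_withFading hp _ Prod.fst).trans
      ((entropy_bitLaw _ _ _).trans (entropy_uniformInput _ _ fun x x' => by
        rw [vBits_eq_iff]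
        exact forall_congr' fun j => by rw [not_and_or, not_le, not_lt]))
  have e3 : entropy (withFading p (bitLaw n m₁ i₀)) (fun ω => (uBits m₁ i₀ (rvX ω), rvV ω)) =
      (Finset.univ.filter fun _ : Fin n => True).card :=
    (entropy_withFading hp _ fun z => (uBits m₁ i₀ z.2, z.1)).trans
      ((entropy_bitLaw _ _ _).trans (entropy_uniformInput _ _ fun x x' => by
        simp only [Prod.mk.injEq, vBits_eq_iff, uBits_eq_iff, ← forall_and]
        refine forall_congr' fun j => ⟨fun h _ => ?_, fun h => ⟨fun _ => h trivial,
          fun _ => h trivial⟩⟩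
        by_cases hj : i₀ ≤ j.val ∧ j.val < m₁
        · exact h.1 hj
        · exact h.2 (by omega)))
  rw [e1, e2, e3, ← Nat.cast_add, Finset.card_filter_add_card_filter_not, Finset.filter_true,
    sub_self]

theorem mutualInfo_uBits_rvY₁ (hi : i₀ ≤ m₁) (hmn : m₁ ≤ n)
    (hp : p ∈ stdSimplex ℝ (Fin (n + 1))) :
    mutualInfo (withFading p (bitLaw n m₁ i₀)) (fun ω => uBits m₁ i₀ (rvX ω)) (rvY₁ m₁) =
      (m₁ : ℝ) - i₀ := by
  rw [mutualInfo_eq (withFading_mem_stdSimplex hp (bitLaw_mem_stdSimplex m₁ i₀)).1]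
  have e1 : entropy (withFading p (bitLaw n m₁ i₀)) (fun ω => uBits m₁ i₀ (rvX ω)) =
      (m₁ : ℝ) - i₀ := by
    refine ((entropy_withFading hp _ fun z => uBits m₁ i₀ z.2).trans
      ((entropy_bitLaw _ _ _).trans (entropy_uniformInput _ _ fun _ _ => uBits_eq_iff))).trans ?_
    rw [card_filter_fin_Ico hmn, Nat.cast_sub hi]
  have e2 : entropy (withFading p (bitLaw n m₁ i₀))
      (fun ω => (uBits m₁ i₀ (rvX ω), rvY₁ m₁ ω)) =
      entropy (withFading p (bitLaw n m₁ i₀)) (rvY₁ m₁) := by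
    refine entropy_congr fun ω ω' _ _ => ?_
    simp only [Prod.mk.injEq, uBits_eq_iff, rvY₁, rvX, topBits_eq_iff]
    exact ⟨fun h => h.2, fun h => ⟨fun j hj => h j hj.2, h⟩⟩
  rw [e1, e2]
  ring

end BitAssignment

/-! ### The threshold -/

section Threshold

variable {n m₁ i₀ : ℕ} {p : Fin (n + 1) → ℝ} {μ : ℝ}

theorem existsUnique_isThreshold (hp : p ∈ stdSimplex ℝ (Fin (n + 1))) (hμ : 0 ≤ μ) :
    ∃! i₀ : ℕ, IsThreshold m₁ p μ i₀ := by
  classical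
  have hanti : ∀ {i k : ℕ}, i ≤ k → μ * tail p k ≤ μ * tail p i := fun h =>
    mul_le_mul_of_nonneg_left (tail_antitone hp.1 h) hμ
  have hmem : ∃ i, i = m₁ ∨ μ * tail p (i + 1) < 1 := ⟨m₁, Or.inl rfl⟩
  refine ⟨Nat.find hmem, ⟨Nat.find_min' hmem (Or.inl rfl), fun h0 => ?_, fun h => ?_⟩, ?_⟩
  · have := Nat.find_min hmem (Nat.sub_lt h0 one_pos)
    rw [not_or, not_lt] at this
    exact (Nat.sub_add_cancel h0) ▸ this.2
  · exact (Nat.find_spec hmem).resolve_left h.ne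
  · rintro i ⟨h1, h2, h3⟩
    refine le_antisymm ?_ (Nat.find_min' hmem ?_)
    · by_contra! hlt
      rcases Nat.find_spec hmem with h | h
      · omega
      · exact (h2 (by omega)).not_gt ((hanti hlt).trans_lt h)
    · exact h1.eq_or_lt.imp id h3

/-- The corner point of the bit assignment `i₀`, in the direction `(1, μ)`. -/
theorem corner_eq (hi : i₀ ≤ m₁) (hmn : m₁ ≤ n) (hp : p ∈ stdSimplex ℝ (Fin (n + 1))) (μ : ℝ) :
    (m₁ : ℝ) - i₀ + μ * rate₂ m₁ p i₀ = ∑ j ∈ Finset.range n,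
      if j < i₀ ∨ m₁ ≤ j then μ * tail p (j + 1) else 1 := by
  have h : ((m₁ : ℝ) - i₀) = ∑ j ∈ Finset.range n, if j < i₀ ∨ m₁ ≤ j then (0 : ℝ) else 1 := by
    rw [← sum_range_threshold hi, ← Finset.sum_range_add_sum_Ico _ hmn, left_eq_add]
    refine Finset.sum_eq_zero fun j hj => ?_
    rw [if_pos (Or.inr (Finset.mem_Ico.1 hj).1)]
  rw [h, rate₂_eq hi hp, Finset.mul_sum, ← Finset.sum_add_distrib]
  refine Finset.sum_congr rfl fun j _ => ?_
  split_ifs <;> ring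

theorem corner_le_optValue (hi : i₀ ≤ m₁) (hmn : m₁ ≤ n) (hp : p ∈ stdSimplex ℝ (Fin (n + 1)))
    (μ : ℝ) : (m₁ : ℝ) - i₀ + μ * rate₂ m₁ p i₀ ≤ optValue m₁ p μ := by
  rw [corner_eq hi hmn hp, optValue_eq m₁ hmn]
  refine Finset.sum_le_sum fun j _ => ?_
  split_ifs with h1 h2
  · exact le_max_right _ _
  · exact le_rfl
  · exact le_max_left _ _
  · omega

theorem corner_eq_optValue (hmn : m₁ ≤ n) (hp : p ∈ stdSimplex ℝ (Fin (n + 1))) (hμ : 0 ≤ μ)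
    (h : IsThreshold m₁ p μ i₀) : (m₁ : ℝ) - i₀ + μ * rate₂ m₁ p i₀ = optValue m₁ p μ := by
  have hanti : ∀ {i k : ℕ}, i ≤ k → μ * tail p k ≤ μ * tail p i := fun h =>
    mul_le_mul_of_nonneg_left (tail_antitone hp.1 h) hμ
  obtain ⟨hi, hge, hlt⟩ := h
  rw [corner_eq hi hmn hp, optValue_eq m₁ hmn]
  refine Finset.sum_congr rfl fun j _ => ?_
  split_ifs with h1 h2
  · exact (max_eq_right ((hge (by omega)).trans (hanti (by omega)))).symm
  · rfl
  · exact (max_eq_left ((hanti (by omega)).trans (hlt (by omega)).le)).symm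
  · omega

theorem objective_bitLaw (hmn : m₁ ≤ n) (hp : p ∈ stdSimplex ℝ (Fin (n + 1))) (hμ : 0 ≤ μ)
    (h : IsThreshold m₁ p μ i₀) : objective m₁ p μ (bitLaw n m₁ i₀) = optValue m₁ p μ := by
  rw [← corner_eq_optValue hmn hp hμ h, objective, condMutualInfo_bitLaw h.1 hmn hp,
    mutualInfo_bitLaw h.1 hp]

end Threshold

/-! ### The explicit region -/

section Region

variable {n m₁ : ℕ} {p : Fin (n + 1) → ℝ}

/-- The region cut out by the supporting lines `R₁ + μ R₂ = F(μ)`. -/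
def dualRegion (m₁ : ℕ) (p : Fin (n + 1) → ℝ) : Set (ℝ × ℝ) :=
  {R | 0 ≤ R.1 ∧ 0 ≤ R.2 ∧ ∀ μ : ℝ, 0 ≤ μ → R.1 + μ * R.2 ≤ optValue m₁ p μ}

theorem explicitRegion_subset_dualRegion (hmn : m₁ ≤ n) (hp : p ∈ stdSimplex ℝ (Fin (n + 1))) :
    explicitRegion m₁ p ⊆ dualRegion m₁ p := by
  refine convexHull_min ?_ ?_
  · intro R hR
    simp only [Set.mem_iUnion, Finset.mem_range, Nat.lt_succ_iff] at hR
    obtain ⟨i, hi, h1, h2, h3, h4⟩ := hR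
    refine ⟨h1, h3, fun μ hμ => le_trans ?_ (corner_le_optValue hi hmn hp μ)⟩
    have := mul_le_mul_of_nonneg_left h4 hμ
    linarith
  · rintro R ⟨h1, h2, h3⟩ S ⟨h4, h5, h6⟩ a b ha hb hab
    refine ⟨add_nonneg (mul_nonneg ha h1) (mul_nonneg hb h4),
      add_nonneg (mul_nonneg ha h2) (mul_nonneg hb h5), fun μ hμ => ?_⟩
    calc _ = a * (R.1 + μ * R.2) + b * (S.1 + μ * S.2) := by
          simp only [Prod.fst_add, Prod.snd_add, Prod.smul_fst, Prod.smul_snd, smul_eq_mul]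
          ring
      _ ≤ a * optValue m₁ p μ + b * optValue m₁ p μ :=
          add_le_add (mul_le_mul_of_nonneg_left (h3 μ hμ) ha)
            (mul_le_mul_of_nonneg_left (h6 μ hμ) hb)
      _ = _ := by rw [← add_mul, hab, one_mul]

/-- The bounds in the directions `(1, μ)` imply the one in the limiting direction `(0, 1)`. -/
theorem snd_le_of_mem_dualRegion (hmn : m₁ ≤ n) (hp : p ∈ stdSimplex ℝ (Fin (n + 1)))
    {R : ℝ × ℝ} (hR : R ∈ dualRegion m₁ p) : R.2 ≤ rate₂ m₁ p m₁ := by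
  by_contra! hlt
  have hd : 0 < R.2 - rate₂ m₁ p m₁ := sub_pos.2 hlt
  have hμ : 0 ≤ (m₁ + 1) / (R.2 - rate₂ m₁ p m₁) := by positivity
  obtain ⟨i, hi, -⟩ := existsUnique_isThreshold (m₁ := m₁) hp hμ
  have h1 := hR.2.2 _ hμ
  rw [← corner_eq_optValue hmn hp hμ hi] at h1
  have h2 := mul_le_mul_of_nonneg_left (rate₂_mono hp m₁ hi.1) hμ
  have h3 : (m₁ + 1) / (R.2 - rate₂ m₁ p m₁) * (R.2 - rate₂ m₁ p m₁) = m₁ + 1 :=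
    div_mul_cancel₀ _ hd.ne'
  rw [mul_sub] at h3
  have h4 : (0 : ℝ) ≤ i := Nat.cast_nonneg _
  have h5 := hR.1
  linarith

/-- The converse inclusion: a point outside of the hull is separated from the corners of the
rectangles by a line, which may be taken to have a direction with nonnegative entries because the
rectangles contain the projections of their corners to the axes. -/
theorem dualRegion_subset_explicitRegion (hmn : m₁ ≤ n) (hp : p ∈ stdSimplex ℝ (Fin (n + 1))) :
    dualRegion m₁ p ⊆ explicitRegion m₁ p := by
  intro R hR
  set C : Set (ℝ × ℝ) := ⋃ i ∈ Finset.range (m₁ + 1),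
    {((0 : ℝ), (0 : ℝ)), ((m₁ : ℝ) - i, 0), (0, rate₂ m₁ p i), ((m₁ : ℝ) - i, rate₂ m₁ p i)} with hC
  have hCR : convexHull ℝ C ⊆ explicitRegion m₁ p := by
    refine convexHull_mono (Set.iUnion₂_mono fun i hi => ?_)
    have h1 : (0 : ℝ) ≤ (m₁ : ℝ) - i :=
      sub_nonneg.2 (by exact_mod_cast Nat.lt_succ_iff.1 (Finset.mem_range.1 hi))
    have h2 := rate₂_nonneg hp m₁ i
    rintro x (rfl | rfl | rfl | rfl) <;> simp [rectangle, h1, h2]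
  refine hCR ?_
  by_contra hnot
  have hfin : C.Finite := (Finset.range (m₁ + 1)).finite_toSet.biUnion fun i _ => Set.toFinite _
  obtain ⟨f, u, hfu, huR⟩ := geometric_hahn_banach_closed_point (convex_convexHull ℝ C)
    (hfin.isCompact_convexHull ℝ).isClosed hnot
  have hf : ∀ x y : ℝ, f (x, y) = x * f (1, 0) + y * f (0, 1) := by
    intro x y
    have : ((x, y) : ℝ × ℝ) = x • (1, 0) + y • (0, 1) := by simp
    rw [this, map_add, map_smul, map_smul, smul_eq_mul, smul_eq_mul]
  set α := f (1, 0)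
  set β := f (0, 1)
  have hcorner : ∀ i ≤ m₁, max α 0 * ((m₁ : ℝ) - i) + max β 0 * rate₂ m₁ p i < u := by
    intro i hi
    have hmem : ∀ x ∈ ({((0 : ℝ), (0 : ℝ)), ((m₁ : ℝ) - i, 0), (0, rate₂ m₁ p i),
        ((m₁ : ℝ) - i, rate₂ m₁ p i)} : Set (ℝ × ℝ)), x.1 * α + x.2 * β < u := fun x hx => by
      rw [← hf]
      exact hfu _ (subset_convexHull ℝ C
        (Set.mem_biUnion (Finset.mem_coe.2 (Finset.mem_range.2 (Nat.lt_succ_of_le hi))) hx))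
    have c1 := hmem (0, 0) (by simp)
    have c2 := hmem ((m₁ : ℝ) - i, 0) (by simp)
    have c3 := hmem (0, rate₂ m₁ p i) (by simp)
    have c4 := hmem ((m₁ : ℝ) - i, rate₂ m₁ p i) (by simp)
    simp only at c1 c2 c3 c4
    rcases le_total α 0 with ha | ha <;> rcases le_total β 0 with hb | hb <;>
      simp only [max_eq_left, max_eq_right, ha, hb] <;> linarith
  have hRu : u < max α 0 * R.1 + max β 0 * R.2 := by
    have h1 := huR
    rw [show R = (R.1, R.2) from rfl, hf] at h1
    have h2 := mul_le_mul_of_nonneg_left (le_max_left α 0) hR.1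
    have h3 := mul_le_mul_of_nonneg_left (le_max_left β 0) hR.2.1
    linarith
  rcases (le_max_right α 0).eq_or_lt with h0 | h0
  · rw [← h0] at hRu hcorner
    have h1 := hcorner m₁ le_rfl
    have h2 := mul_le_mul_of_nonneg_left (snd_le_of_mem_dualRegion hmn hp hR) (le_max_right β 0)
    linarith
  · have hμ : 0 ≤ max β 0 / max α 0 := div_nonneg (le_max_right _ _) h0.le
    obtain ⟨i, hi, -⟩ := existsUnique_isThreshold (m₁ := m₁) hp hμ
    have h1 := hR.2.2 _ hμ
    rw [← corner_eq_optValue hmn hp hμ hi] at h1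
    have h2 := mul_le_mul_of_nonneg_left h1 h0.le
    have h3 : ∀ x : ℝ, max α 0 * (max β 0 / max α 0 * x) = max β 0 * x := fun x => by
      rw [← mul_assoc, mul_div_cancel₀ _ h0.ne']
    rw [mul_add, mul_add, h3, h3] at h2
    have := hcorner i hi.1
    linarith

theorem explicitRegion_eq_dualRegion (hmn : m₁ ≤ n) (hp : p ∈ stdSimplex ℝ (Fin (n + 1))) :
    explicitRegion m₁ p = dualRegion m₁ p :=
  (explicitRegion_subset_dualRegion hmn hp).antisymm (dualRegion_subset_explicitRegion hmn hp)

/-- The points of the hull are dominated by mixtures of the corners. -/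
theorem exists_weights_of_mem_explicitRegion {R : ℝ × ℝ} (hR : R ∈ explicitRegion m₁ p) :
    0 ≤ R.1 ∧ 0 ≤ R.2 ∧ ∃ w ∈ stdSimplex ℝ (Fin (m₁ + 1)),
      R.1 ≤ ∑ i, w i * ((m₁ : ℝ) - i.val) ∧ R.2 ≤ ∑ i, w i * rate₂ m₁ p i.val := by
  refine convexHull_min (t := {R : ℝ × ℝ | 0 ≤ R.1 ∧ 0 ≤ R.2 ∧ ∃ w ∈ stdSimplex ℝ (Fin (m₁ + 1)),
    R.1 ≤ ∑ i, w i * ((m₁ : ℝ) - i.val) ∧ R.2 ≤ ∑ i, w i * rate₂ m₁ p i.val}) ?_ ?_ hR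
  · intro R hR
    simp only [Set.mem_iUnion, Finset.mem_range] at hR
    obtain ⟨i, hi, h1, h2, h3, h4⟩ := hR
    refine ⟨h1, h3, Pi.single ⟨i, hi⟩ 1, single_mem_stdSimplex ℝ _, ?_, ?_⟩ <;>
      simpa [Pi.single_apply]
  · rintro R ⟨h1, h2, w, hw, h3, h4⟩ S ⟨h5, h6, v, hv, h7, h8⟩ a b ha hb hab
    refine ⟨add_nonneg (mul_nonneg ha h1) (mul_nonneg hb h5),
      add_nonneg (mul_nonneg ha h2) (mul_nonneg hb h6), a • w + b • v,
      convex_stdSimplex ℝ _ hw hv ha hb hab, ?_, ?_⟩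
    · calc a * R.1 + b * S.1 ≤ a * ∑ i, w i * ((m₁ : ℝ) - i.val) +
            b * ∑ i, v i * ((m₁ : ℝ) - i.val) := by gcongr
        _ = _ := by
          rw [Finset.mul_sum, Finset.mul_sum, ← Finset.sum_add_distrib]
          refine Finset.sum_congr rfl fun i _ => ?_
          simp only [Pi.add_apply, Pi.smul_apply, smul_eq_mul]
          ring
    · calc a * R.2 + b * S.2 ≤ a * ∑ i, w i * rate₂ m₁ p i.val +
            b * ∑ i, v i * rate₂ m₁ p i.val := by gcongr
        _ = _ := by
          rw [Finset.mul_sum, Finset.mul_sum, ← Finset.sum_add_distrib]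
          refine Finset.sum_congr rfl fun i _ => ?_
          simp only [Pi.add_apply, Pi.smul_apply, smul_eq_mul]
          ring

end Region

/-! ### The Körner–Marton bound -/

section KornerMarton

variable {n m₁ : ℕ} {p : Fin (n + 1) → ℝ}

theorem tail_le_one (hp : p ∈ stdSimplex ℝ (Fin (n + 1))) (j : ℕ) : tail p j ≤ 1 := by
  rw [← hp.2]
  refine Finset.sum_le_sum fun i _ => ?_
  split_ifs
  · exact le_rfl
  · exact hp.1 i

theorem mutualInfo_rvX_rvY₁ {V : Type} [Fintype V] (hp : p ∈ stdSimplex ℝ (Fin (n + 1)))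
    {P : V × Input n → ℝ} (hP : P ∈ stdSimplex ℝ (V × Input n)) (m₁ : ℕ) :
    mutualInfo (withFading p P) rvX (rvY₁ m₁) =
      ∑ j ∈ Finset.range m₁, bitEntropy P (fun _ => ()) Prod.snd j := by
  have h1 : entropy (withFading p P) (fun ω => (rvX ω, rvY₁ m₁ ω)) =
      entropy (withFading p P) rvX := entropy_congr fun ω ω' _ _ => by
    simp only [Prod.mk.injEq, rvY₁, rvX]
    exact ⟨fun h => h.1, fun h => ⟨h, by rw [h]⟩⟩
  have h2 : entropy (withFading p P) (rvY₁ m₁) = prefixEntropy P (fun _ => ()) Prod.snd m₁ :=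
    (entropy_withFading hp P fun z => topBits m₁ z.2).trans (prefixEntropy_unit _ _ _).symm
  rw [mutualInfo_eq (withFading_mem_stdSimplex hp hP).1, h1, h2, prefixEntropy_eq_add_sum,
    prefixEntropy_zero, entropy_of_subsingleton hP]
  ring

theorem condMutualInfo_rvY₂ {V : Type} [Fintype V] (hp : p ∈ stdSimplex ℝ (Fin (n + 1)))
    {P : V × Input n → ℝ} (hP : P ∈ stdSimplex ℝ (V × Input n)) :
    condMutualInfo (withFading p P) rvX rvY₂ rvV =
      ∑ j ∈ Finset.range n, tail p (j + 1) * bitEntropy P Prod.fst Prod.snd j := by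
  have hW := withFading_mem_stdSimplex hp hP
  have h1 := mutualInfo_rvY₂ hp hP Prod.fst
  have h2 := mutualInfo_rvY₂ hp hP fun z => z
  have h3 : ∀ j < n, bitEntropy P (fun z => z) Prod.snd j = 0 := fun j hj => by
    have h : ∀ k, prefixEntropy P (fun z => z) Prod.snd k = entropy P fun z => z := fun k =>
      entropy_congr fun z z' _ _ => by
        simp only [Prod.mk.injEq]
        exact ⟨fun e => e.1, fun e => ⟨e, by rw [e]⟩⟩
    rw [bitEntropy, h, h, sub_self]
  have h4 : entropy (withFading p P) (fun ω => (rvX ω, rvV ω)) =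
      entropy (withFading p P) (fun ω => (ω.1, ω.2.1)) :=
    entropy_congr fun ω ω' _ _ => by simp [rvX, rvV, and_comm]
  have h5 : entropy (withFading p P) (fun ω => (rvX ω, rvY₂ ω, rvV ω)) =
      entropy (withFading p P) (fun ω => ((ω.1, ω.2.1), rvY₂ ω)) :=
    entropy_congr fun ω ω' _ _ => by
      simp only [rvX, rvV, Prod.mk.injEq]
      tauto
  have h6 : entropy (withFading p P) (fun ω => (rvY₂ ω, rvV ω)) =
      entropy (withFading p P) (fun ω => (ω.1, rvY₂ ω)) :=
    entropy_congr fun ω ω' _ _ => by simp [rvV, and_comm]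
  have h7 : entropy (withFading p P) rvV = entropy (withFading p P) (fun ω => ω.1) := rfl
  rw [mutualInfo_eq hW.1] at h1 h2
  rw [condMutualInfo, condEntropy_eq hW.1, condEntropy_eq hW.1, h4, h5, h6, h7]
  have h8 : ∑ j ∈ Finset.range n, tail p (j + 1) * (bitEntropy P (fun _ => ()) Prod.snd j -
      bitEntropy P (fun z => z) Prod.snd j) = ∑ j ∈ Finset.range n, tail p (j + 1) *
      (bitEntropy P (fun _ => ()) Prod.snd j - bitEntropy P Prod.fst Prod.snd j) +
      ∑ j ∈ Finset.range n, tail p (j + 1) * bitEntropy P Prod.fst Prod.snd j := by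
    rw [← Finset.sum_add_distrib]
    refine Finset.sum_congr rfl fun j hj => ?_
    rw [h3 j (Finset.mem_range.1 hj)]
    ring
  rw [h8] at h2
  linarith

/-- For `μ ≥ 1`, the bound in direction `(1, μ)` is the sum-rate bound plus `μ - 1` times the bound
on `R₂`; for `μ ≤ 1` it is a mixture of the bound on `R₁` and the sum-rate bound. -/
theorem kornerMartonTwo_subset (hmn : m₁ ≤ n) (hp : p ∈ stdSimplex ℝ (Fin (n + 1))) :
    kornerMartonTwo m₁ p ⊆ dualRegion m₁ p := by
  rintro R ⟨h1, h2, V, _, P, hP, hR₁, hR₂, hR⟩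
  refine ⟨h1, h2, fun μ hμ => ?_⟩
  rcases le_total 1 μ with h | h
  · refine le_trans ?_ (objective_le_optValue hp hP hmn hμ)
    rw [objective]
    have := mul_le_mul_of_nonneg_left hR₂ (sub_nonneg.2 h)
    linarith
  · have e1 : R.1 ≤ m₁ := by
      rw [mutualInfo_rvX_rvY₁ hp hP] at hR₁
      refine hR₁.trans ((Finset.sum_le_sum fun j hj => bitEntropy_le_one hP _ _
        ((Finset.mem_range.1 hj).trans_le hmn)).trans_eq ?_)
      simp
    have e2 : ∀ ν : ℝ, 0 ≤ ν → ν ≤ 1 →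
        optValue m₁ p ν = m₁ + ν * ∑ j ∈ Finset.Icc (m₁ + 1) n, tail p j := fun ν h0 h1 => by
      rw [optValue, Finset.sum_congr rfl (g := fun _ => (1 : ℝ)) fun j _ =>
        max_eq_left (mul_le_one₀ h1 (tail_nonneg hp.1 j) (tail_le_one hp j))]
      simp
    have e3 : R.1 + R.2 ≤ optValue m₁ p 1 := by
      refine le_trans ?_ (objective_le_optValue hp hP hmn zero_le_one)
      rw [objective, one_mul]
      exact hR
    rw [e2 1 zero_le_one le_rfl, one_mul] at e3
    rw [e2 μ hμ h]
    have e4 := mul_le_mul_of_nonneg_left e3 hμ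
    have e5 := mul_le_mul_of_nonneg_left e1 (sub_nonneg.2 h)
    linarith

/-- The law of `(V, X)` for time sharing: `X` is uniform, and `V` consists of an independent
choice of a bit assignment and the bits which this assignment gives to receiver 2. -/
noncomputable def timeSharingLaw (n m₁ : ℕ) (w : Fin (m₁ + 1) → ℝ) :
    (Σ i : Fin (m₁ + 1), VBits n m₁ i.val) × Input n → ℝ :=
  law (prodWeight (uniformInput n) w) (fun z => (⟨z.2, vBits m₁ z.2.val z.1⟩, z.1))

variable {w : Fin (m₁ + 1) → ℝ}

theorem timeSharingLaw_mem_stdSimplex (hw : w ∈ stdSimplex ℝ (Fin (m₁ + 1))) :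
    timeSharingLaw n m₁ w ∈ stdSimplex ℝ _ :=
  law_mem_stdSimplex (prodWeight_mem_stdSimplex uniformInput_mem_stdSimplex hw) _

theorem bitEntropy_timeSharingLaw_unit (hw : w ∈ stdSimplex ℝ (Fin (m₁ + 1))) {j : ℕ}
    (hj : j < n) : bitEntropy (timeSharingLaw n m₁ w) (fun _ => ()) Prod.snd j = 1 := by
  rw [timeSharingLaw, bitEntropy_law, ← bitEntropy_uniformInput hj]
  have h : ∀ k, prefixEntropy (prodWeight (uniformInput n) w) (fun _ => ()) (fun z => z.1) k =
      prefixEntropy (uniformInput n) (fun _ => ()) (fun x => x) k := fun k =>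
    entropy_prodWeight_fst (uniformInput n) hw.2 fun x => ((), topBits k x)
  rw [bitEntropy, h, h, bitEntropy]

theorem bitEntropy_timeSharingLaw {j : ℕ} (hj : j < n) :
    bitEntropy (timeSharingLaw n m₁ w) Prod.fst Prod.snd j =
      ∑ i : Fin (m₁ + 1), w i * if j < i.val ∨ m₁ ≤ j then 0 else 1 := by
  have h : ∀ k, prefixEntropy (prodWeight (uniformInput n) w)
      (fun z => (⟨z.2, vBits m₁ z.2.val z.1⟩ : Σ i : Fin (m₁ + 1), VBits n m₁ i.val))
      (fun z => z.1) k = (-∑ i, w i * Real.logb 2 (w i)) +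
        ∑ i : Fin (m₁ + 1), w i * prefixEntropy (uniformInput n) (vBits m₁ i.val) (fun x => x) k := by
    intro k
    refine Eq.trans (entropy_congr fun z z' _ _ => ?_) (entropy_prodWeight_sigma
      uniformInput_mem_stdSimplex w (fun (i : Fin (m₁ + 1)) x => (vBits m₁ i.val x, topBits k x)))
    obtain ⟨x, i⟩ := z
    obtain ⟨x', i'⟩ := z'
    simp only [Prod.mk.injEq]
    constructor
    · rintro ⟨h1, h2⟩
      obtain ⟨rfl, h3⟩ := Sigma.mk.inj_iff.1 h1
      rw [h2, eq_of_heq h3]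
    · intro h2
      obtain ⟨rfl, h3⟩ := Sigma.mk.inj_iff.1 h2
      simp only [heq_eq_eq, Prod.mk.injEq] at h3
      rw [h3.1, h3.2]
      exact ⟨rfl, rfl⟩
  rw [timeSharingLaw, bitEntropy_law, bitEntropy]
  simp only [h]
  rw [add_sub_add_left_eq_sub, ← Finset.sum_sub_distrib]
  refine Finset.sum_congr rfl fun i _ => ?_
  rw [← bitEntropy_uniformInput_of_iff (fun j => j < i.val ∨ m₁ ≤ j) (vBits m₁ i.val)
    (fun x x' => vBits_eq_iff) hj, bitEntropy, mul_sub]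

theorem explicitRegion_subset_kornerMartonTwo (hmn : m₁ ≤ n)
    (hp : p ∈ stdSimplex ℝ (Fin (n + 1))) : explicitRegion m₁ p ⊆ kornerMartonTwo m₁ p := by
  intro R hR
  obtain ⟨h1, h2, w, hw, hR₁, hR₂⟩ := exists_weights_of_mem_explicitRegion hR
  have hP := timeSharingLaw_mem_stdSimplex (n := n) hw
  have e1 : mutualInfo (withFading p (timeSharingLaw n m₁ w)) rvX (rvY₁ m₁) = m₁ := by
    rw [mutualInfo_rvX_rvY₁ hp hP, Finset.sum_congr rfl fun j hj =>
      bitEntropy_timeSharingLaw_unit hw ((Finset.mem_range.1 hj).trans_le hmn)]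
    simp
  have e2 : condMutualInfo (withFading p (timeSharingLaw n m₁ w)) rvX (rvY₁ m₁) rvV =
      ∑ i, w i * ((m₁ : ℝ) - i.val) := by
    rw [condMutualInfo_rvY₁ hp hP, Finset.sum_congr rfl fun j hj =>
      bitEntropy_timeSharingLaw ((Finset.mem_range.1 hj).trans_le hmn), Finset.sum_comm]
    refine Finset.sum_congr rfl fun i _ => ?_
    rw [← Finset.mul_sum, sum_range_threshold (Nat.lt_succ_iff.1 i.2)]
  have e3 : mutualInfo (withFading p (timeSharingLaw n m₁ w)) rvV rvY₂ =
      ∑ i, w i * rate₂ m₁ p i.val := by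
    refine (mutualInfo_rvY₂ hp hP Prod.fst).trans ?_
    simp only [fun i : Fin (m₁ + 1) => rate₂_eq (Nat.lt_succ_iff.1 i.2) hp, Finset.mul_sum]
    rw [Finset.sum_comm]
    refine Finset.sum_congr rfl fun j hj => ?_
    rw [bitEntropy_timeSharingLaw (Finset.mem_range.1 hj),
      bitEntropy_timeSharingLaw_unit hw (Finset.mem_range.1 hj), ← hw.2, ← Finset.sum_sub_distrib,
      Finset.mul_sum]
    refine Finset.sum_congr rfl fun i _ => ?_
    simp only [hw.2]
    split_ifs <;> ring
  refine ⟨h1, h2, _, inferInstance, timeSharingLaw n m₁ w, hP, ?_, ?_, ?_⟩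
  · rw [e1]
    refine hR₁.trans ?_
    calc ∑ i, w i * ((m₁ : ℝ) - i.val) ≤ ∑ i, w i * (m₁ : ℝ) :=
          Finset.sum_le_sum fun i _ => mul_le_mul_of_nonneg_left
            (sub_le_self _ (Nat.cast_nonneg _)) (hw.1 i)
      _ = m₁ := by rw [← Finset.sum_mul, hw.2, one_mul]
  · rw [e3]
    exact hR₂
  · rw [e2, e3]
    exact add_le_add hR₁ hR₂

/-- With uniform bits and `U = Y₁`, the bounds of `kornerMartonOne` are the largest values that
`R₁`, `R₂` and `R₁ + R₂` take on the region. -/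
theorem explicitRegion_subset_kornerMartonOne (hmn : m₁ ≤ n)
    (hp : p ∈ stdSimplex ℝ (Fin (n + 1))) : explicitRegion m₁ p ⊆ kornerMartonOne m₁ p := by
  intro R hR
  have hD := explicitRegion_subset_dualRegion hmn hp hR
  set P : TopBits n m₁ × Input n → ℝ :=
    law (uniformInput n) (fun x => (topBits m₁ x, x)) with hPdef
  have hP : P ∈ stdSimplex ℝ _ := law_mem_stdSimplex uniformInput_mem_stdSimplex _
  have ha : ∀ j < n, bitEntropy P (fun _ => ()) Prod.snd j = 1 := fun j hj => by
    rw [hPdef, bitEntropy_law]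
    exact bitEntropy_uniformInput hj
  have hb : ∀ j < n, bitEntropy P Prod.fst Prod.snd j = if j < m₁ then 0 else 1 := fun j hj => by
    rw [hPdef, bitEntropy_law]
    exact bitEntropy_uniformInput_of_iff (fun j => j < m₁) _ (fun x x' => topBits_eq_iff) hj
  have e1 : mutualInfo (withFading p P) rvX rvY₂ = ∑ j ∈ Finset.range n, tail p (j + 1) := by
    refine (mutualInfo_rvY₂ hp hP Prod.snd).trans (Finset.sum_congr rfl fun j hj => ?_)
    have h0 : ∀ k, prefixEntropy P Prod.snd Prod.snd k = entropy P Prod.snd := fun k =>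
      entropy_congr fun z z' _ _ => by
        simp only [Prod.mk.injEq]
        exact ⟨fun e => e.1, fun e => ⟨e, by rw [e]⟩⟩
    rw [ha j (Finset.mem_range.1 hj), bitEntropy, h0, h0]
    ring
  have e2 : mutualInfo (withFading p P) rvV (rvY₁ m₁) = m₁ := by
    have h1 : ∀ {α : Type} [Fintype α] (f : TopBits n m₁ × Input n → α),
        (∀ x x' : Input n, f (topBits m₁ x, x) = f (topBits m₁ x', x') ↔
          topBits m₁ x = topBits m₁ x') →
        entropy (withFading p P) (fun ω => f (ω.1, ω.2.1)) = m₁ := fun f hf => by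
      rw [entropy_withFading hp, hPdef, entropy_law,
        entropy_uniformInput (fun j => 0 ≤ j.val ∧ j.val < m₁), card_filter_fin_Ico hmn,
        Nat.sub_zero]
      exact fun x x' => by rw [hf, topBits_eq_iff]; simp
    rw [mutualInfo_eq (withFading_mem_stdSimplex hp hP).1]
    have h2 := h1 Prod.fst fun x x' => Iff.rfl
    have h3 := h1 (fun z => topBits m₁ z.2) fun x x' => Iff.rfl
    have h4 := h1 (fun z => (z.1, topBits m₁ z.2)) fun x x' => by simp
    change entropy (withFading p P) rvV = _ at h2
    change entropy (withFading p P) (rvY₁ m₁) = _ at h3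
    change entropy (withFading p P) (fun ω => (rvV ω, rvY₁ m₁ ω)) = _ at h4
    rw [h2, h3, h4]
    ring
  have e3 : condMutualInfo (withFading p P) rvX rvY₂ rvV + m₁ = optValue m₁ p 1 := by
    have hm : (m₁ : ℝ) = ∑ j ∈ Finset.range n, if j < m₁ then (1 : ℝ) else 0 := by
      have : (Finset.range n).filter (fun j => j < m₁) = Finset.range m₁ := by
        ext j
        simp only [Finset.mem_filter, Finset.mem_range]
        omega
      rw [← Finset.sum_filter, this]
      simp
    rw [condMutualInfo_rvY₂ hp hP, optValue_eq m₁ hmn, hm, ← Finset.sum_add_distrib]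
    refine Finset.sum_congr rfl fun j hj => ?_
    rw [hb j (Finset.mem_range.1 hj), one_mul, max_eq_left (tail_le_one hp _)]
    split_ifs <;> ring
  refine ⟨hD.1, hD.2.1, _, inferInstance, P, hP, ?_, ?_, ?_⟩
  · have := snd_le_of_mem_dualRegion hmn hp hD
    rw [rate₂_eq le_rfl hp] at this
    rw [e1]
    refine this.trans (Finset.sum_le_sum fun j _ => ?_)
    rw [if_pos (lt_or_ge j m₁), mul_one]
  · rw [e2]
    have h0 := hD.2.2 0 le_rfl
    simpa [optValue] using h0
  · rw [e2, e3]
    simpa using hD.2.2 1 zero_le_one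

end KornerMarton

/-! ### Fading sequences -/

section FadingSequence

variable {ι : Type*} [Fintype ι] {N : ℕ} {p : ι → ℝ}

theorem sum_prod_eq_prod_sum (f : Fin N → ι → ℝ) :
    ∑ s : Fin N → ι, ∏ t, f t (s t) = ∏ t, ∑ i, f t i := by
  classical
  rw [Finset.prod_univ_sum, Fintype.piFinset_univ]

theorem sum_prod_weights (hp : p ∈ stdSimplex ℝ ι) : ∑ s : Fin N → ι, ∏ t, p (s t) = 1 := by
  rw [sum_prod_eq_prod_sum fun _ => p]
  simp [hp.2]

/-- Under the product weights each coordinate has law `p`. -/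
theorem sum_prod_weights_mul (hp : p ∈ stdSimplex ℝ ι) (g : Fin N → ι → ℝ) :
    ∑ s : Fin N → ι, (∏ t, p (s t)) * ∑ t, g t (s t) = ∑ t, ∑ i, p i * g t i := by
  classical
  simp only [Finset.mul_sum]
  rw [Finset.sum_comm]
  refine Finset.sum_congr rfl fun t₀ _ => ?_
  have h := sum_prod_eq_prod_sum fun (t : Fin N) i => p i * if t = t₀ then g t i else 1
  rw [Finset.prod_eq_single t₀ (fun t _ ht => by simp [ht, hp.2]) (by simp)] at h
  simp only [if_true] at h
  rw [← h]
  refine Finset.sum_congr rfl fun s _ => ?_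
  rw [Finset.prod_mul_distrib]
  congr 1
  rw [Finset.prod_eq_single t₀ (fun t _ ht => by simp [ht]) (by simp)]
  simp

end FadingSequence

/-! ### The converse -/

section Past

variable {Ω γ : Type*} {n m₁ N : ℕ}

/-- The side information `W` together with the first `t` outputs at receiver 1. -/
def past (m₁ : ℕ) (W : Ω → γ) (X : Ω → Fin N → Input n) (t : ℕ) (ω : Ω) :
    γ × ({τ : Fin N // τ.val < t} → TopBits n m₁) :=
  (W ω, fun τ => topBits m₁ (X ω τ.1))

theorem past_eq_iff {W : Ω → γ} {X : Ω → Fin N → Input n} {t : ℕ} {ω ω' : Ω} :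
    past m₁ W X t ω = past m₁ W X t ω' ↔
      W ω = W ω' ∧ ∀ τ : Fin N, τ.val < t → topBits m₁ (X ω τ) = topBits m₁ (X ω' τ) := by
  simp [past, funext_iff]

theorem forall_lt_succ_iff {q : Fin N → Prop} (t : Fin N) :
    (∀ τ : Fin N, τ.val < t.val + 1 → q τ) ↔ q t ∧ ∀ τ : Fin N, τ.val < t.val → q τ := by
  constructor
  · exact fun h => ⟨h t (Nat.lt_succ_self _), fun τ hτ => h τ (Nat.lt_succ_of_lt hτ)⟩
  · rintro ⟨h1, h2⟩ τ hτ
    rcases Nat.lt_succ_iff_lt_or_eq.1 hτ with h | h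
    · exact h2 τ h
    · exact Fin.ext h ▸ h1

end Past

section Multiletter

variable {Ω γ : Type*} [Fintype Ω] [Fintype γ] {n m₁ N : ℕ}

/-- Chain rule for the block output of receiver 1. -/
theorem entropy_block_rvY₁ (P : Ω → ℝ) (W : Ω → γ) (X : Ω → Fin N → Input n) :
    entropy P (fun ω => (W ω, fun t => topBits m₁ (X ω t))) = entropy P W +
      ∑ t : Fin N, ∑ j ∈ Finset.range m₁,
        bitEntropy P (past m₁ W X t.val) (fun ω => X ω t) j := by
  have hstep : ∀ t : Fin N, ∑ j ∈ Finset.range m₁,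
      bitEntropy P (past m₁ W X t.val) (fun ω => X ω t) j =
      entropy P (past m₁ W X (t.val + 1)) - entropy P (past m₁ W X t.val) := by
    intro t
    rw [← sub_eq_iff_eq_add'.2 (prefixEntropy_eq_add_sum P _ _ _), prefixEntropy_zero]
    congr 1
    refine entropy_congr fun ω ω' _ _ => ?_
    simp only [Prod.mk.injEq, past_eq_iff, forall_lt_succ_iff]
    tauto
  rw [Finset.sum_congr rfl fun t _ => hstep t,
    Fin.sum_univ_eq_sum_range (fun t => entropy P (past m₁ W X (t + 1)) - entropy P (past m₁ W X t)),
    Finset.sum_range_sub fun t => entropy P (past m₁ W X t)]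
  have h0 : entropy P (past m₁ W X 0) = entropy P W :=
    entropy_congr fun ω ω' _ _ => by simp [past_eq_iff]
  have hN : entropy P (past m₁ W X N) =
      entropy P (fun ω => (W ω, fun t => topBits m₁ (X ω t))) :=
    entropy_congr fun ω ω' _ _ => by simp [past_eq_iff, funext_iff]
  rw [h0, hN]
  ring

/-- Lower bound on the block entropy at receiver 2 for a fixed fading sequence. Drop the bits
below level `m₁`, and in the chain rule condition on the full past of receiver 1 instead of the
part of it that receiver 2 sees. -/
theorem le_entropy_block_rvY₂ {P : Ω → ℝ} (hP : P ∈ stdSimplex ℝ Ω) (W : Ω → γ)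
    (X : Ω → Fin N → Input n) (s : Fin N → Fin (n + 1)) :
    entropy P W + ∑ t : Fin N, ∑ j ∈ Finset.range (min (s t).val m₁),
        bitEntropy P (past m₁ W X t.val) (fun ω => X ω t) j ≤
      entropy P (fun ω => (W ω, fun t => fadedOutput (s t) (X ω t))) := by
  set S : ℕ → ℝ := fun t => entropy P (fun ω => (W ω,
    fun τ : {τ : Fin N // τ.val < t} => topBits (min (s τ.1).val m₁) (X ω τ.1))) with hS
  have hstep : ∀ t : Fin N, ∑ j ∈ Finset.range (min (s t).val m₁),
      bitEntropy P (past m₁ W X t.val) (fun ω => X ω t) j ≤ S (t.val + 1) - S t.val := by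
    intro t
    have h1 := condEntropy_le_of_determines hP
      (fun ω => topBits (min (s t).val m₁) (X ω t)) (g := past m₁ W X t.val)
      (h := fun ω => (W ω,
        fun τ : {τ : Fin N // τ.val < t.val} => topBits (min (s τ.1).val m₁) (X ω τ.1)))
      fun ω ω' h => by
        rw [past_eq_iff] at h
        simp only [Prod.mk.injEq, funext_iff (f := fun τ : {τ : Fin N // τ.val < t.val} => _),
          Subtype.forall]
        exact ⟨h.1, fun τ hτ => topBits_mono (min_le_right _ _) (h.2 τ hτ)⟩
    rw [condEntropy_eq hP.1, condEntropy_eq hP.1] at h1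
    rw [← sub_eq_iff_eq_add'.2 (prefixEntropy_eq_add_sum P _ _ _), prefixEntropy_zero]
    refine le_trans (le_of_eq ?_) (h1.trans_eq ?_)
    · congr 1
      exact entropy_congr fun ω ω' _ _ => by
        simp only [Prod.mk.injEq]
        exact and_comm
    · congr 1
      refine entropy_congr fun ω ω' _ _ => ?_
      simp only [Prod.mk.injEq, funext_iff (f := fun τ : {τ : Fin N // τ.val < _} => _),
        Subtype.forall, forall_lt_succ_iff]
      tauto
  have hsum := Finset.sum_le_sum fun t (_ : t ∈ Finset.univ) => hstep t
  rw [Fin.sum_univ_eq_sum_range (fun t => S (t + 1) - S t), Finset.sum_range_sub] at hsum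
  have h0 : S 0 = entropy P W := entropy_congr fun ω ω' _ _ => by simp [funext_iff]
  have hN : S N ≤ entropy P (fun ω => (W ω, fun t => fadedOutput (s t) (X ω t))) := by
    refine entropy_mono hP.1 fun ω ω' h => ?_
    simp only [Prod.mk.injEq] at h ⊢
    refine ⟨h.1, funext fun τ => topBits_mono (min_le_left _ _) ?_⟩
    exact eq_of_heq (Sigma.mk.inj_iff.1 (congrFun h.2 τ.1)).2
  linarith

theorem entropy_block_rvY₂_le {P : Ω → ℝ} (hP : P ∈ stdSimplex ℝ Ω)
    (X : Ω → Fin N → Input n) (s : Fin N → Fin (n + 1)) :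
    entropy P (fun ω t => fadedOutput (s t) (X ω t)) ≤ ∑ t, ((s t).val : ℝ) := by
  have h : entropy P (fun ω t => fadedOutput (s t) (X ω t)) =
      entropy P (fun ω t => topBits (s t).val (X ω t)) := entropy_congr fun ω ω' _ _ => by
    rw [funext_iff, funext_iff]
    exact forall_congr' fun t => by simp [fadedOutput]
  rw [h]
  refine (entropy_le_logb_card hP _).trans_eq ?_
  have hc : ∀ i : Fin (n + 1), Fintype.card (TopBits n i.val) = 2 ^ i.val := fun i => by
    have := card_filter_fin_Ico (n := n) (a := 0) (Nat.lt_succ_iff.1 i.2)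
    simp only [Nat.zero_le, true_and, Nat.sub_zero] at this
    rw [Fintype.card_fun, Fintype.card_bool, Fintype.card_subtype, this]
  rw [Fintype.card_pi, Finset.prod_congr rfl fun t _ => hc (s t), Finset.prod_pow_eq_pow_sum]
  push_cast
  rw [Real.logb_pow, Real.logb_self_eq_one one_lt_two, mul_one]
  push_cast
  rfl

/-- The block version of the optimization problem: averaged over the fading, an observer with side
information `W` satisfies `H(Y₁ | W) + μ I(W; Y₂) ≤ N F(μ)`. -/
theorem block_bound {P : Ω → ℝ} (hP : P ∈ stdSimplex ℝ Ω) (W : Ω → γ)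
    (X : Ω → Fin N → Input n) (hmn : m₁ ≤ n) {p : Fin (n + 1) → ℝ}
    (hp : p ∈ stdSimplex ℝ (Fin (n + 1))) {μ : ℝ} (hμ : 0 ≤ μ) :
    entropy P (fun ω => (W ω, fun t => topBits m₁ (X ω t))) - entropy P W +
      μ * ∑ s : Fin N → Fin (n + 1), (∏ t, p (s t)) *
        (entropy P W + entropy P (fun ω t => fadedOutput (s t) (X ω t)) -
          entropy P (fun ω => (W ω, fun t => fadedOutput (s t) (X ω t)))) ≤
      N * optValue m₁ p μ := by
  set b : Fin N → ℕ → ℝ := fun t j => bitEntropy P (past m₁ W X t.val) (fun ω => X ω t) j with hb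
  have h1 : ∑ s : Fin N → Fin (n + 1), (∏ t, p (s t)) *
        (entropy P W + entropy P (fun ω t => fadedOutput (s t) (X ω t)) -
          entropy P (fun ω => (W ω, fun t => fadedOutput (s t) (X ω t)))) ≤
      ∑ t : Fin N, ∑ j ∈ Finset.range n, tail p (j + 1) * (1 - if j < m₁ then b t j else 0) := by
    calc _ ≤ ∑ s : Fin N → Fin (n + 1), (∏ t, p (s t)) *
          ∑ t, (((s t).val : ℝ) - ∑ j ∈ Finset.range (min (s t).val m₁), b t j) := by
          refine Finset.sum_le_sum fun s _ => mul_le_mul_of_nonneg_left ?_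
            (Finset.prod_nonneg fun t _ => hp.1 _)
          have e1 := entropy_block_rvY₂_le hP X s
          have e2 := le_entropy_block_rvY₂ (m₁ := m₁) hP W X s
          rw [Finset.sum_sub_distrib]
          linarith
      _ = ∑ t : Fin N, ∑ i : Fin (n + 1), p i *
          ((i.val : ℝ) - ∑ j ∈ Finset.range (min i.val m₁), b t j) :=
          sum_prod_weights_mul hp fun t i =>
            ((i.val : ℝ) - ∑ j ∈ Finset.range (min i.val m₁), b t j)
      _ = _ := by
          refine Finset.sum_congr rfl fun t _ => ?_
          rw [sum_mul_eq_tail hp.2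
            fun i => ((i : ℝ) - ∑ j ∈ Finset.range (min i m₁), b t j)]
          simp only [Nat.cast_zero, Nat.zero_min, Finset.range_zero, Finset.sum_empty, sub_zero,
            zero_add]
          refine Finset.sum_congr rfl fun j _ => ?_
          congr 1
          push_cast
          split_ifs with hj
          · rw [min_eq_left hj, min_eq_left hj.le, Finset.sum_range_succ]
            ring
          · rw [min_eq_right (by omega), min_eq_right (by omega)]
            ring
  have h2 : entropy P (fun ω => (W ω, fun t => topBits m₁ (X ω t))) - entropy P W =
      ∑ t : Fin N, ∑ j ∈ Finset.range n, if j < m₁ then b t j else 0 := by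
    rw [entropy_block_rvY₁, add_sub_cancel_left]
    refine Finset.sum_congr rfl fun t _ => ?_
    rw [← Finset.sum_filter]
    congr 1
    ext j
    simp only [Finset.mem_filter, Finset.mem_range]
    omega
  rw [h2]
  refine (add_le_add_right (mul_le_mul_of_nonneg_left h1 hμ) _).trans ?_
  rw [Finset.mul_sum, ← Finset.sum_add_distrib]
  have h3 : (N : ℝ) * optValue m₁ p μ = ∑ _t : Fin N, optValue m₁ p μ := by simp
  rw [h3]
  refine Finset.sum_le_sum fun t _ => ?_
  rw [optValue_eq m₁ hmn, Finset.mul_sum, ← Finset.sum_add_distrib]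
  refine Finset.sum_le_sum fun j hj => ?_
  have hb0 : 0 ≤ b t j := bitEntropy_nonneg hP.1 _ _ _
  have hb1 : b t j ≤ 1 := bitEntropy_le_one hP _ _ (Finset.mem_range.1 hj)
  have h4 := bit_contribution_le (b := if j < m₁ then b t j else 0) (by split_ifs <;> simp [hb0])
    (by split_ifs <;> simp [hb1]) le_rfl (mul_nonneg hμ (tail_nonneg hp.1 (j + 1))) (j < m₁)
  split_ifs at h4 ⊢ <;> linarith

end Multiletter

section Converse

variable {n m₁ N K₁ K₂ : ℕ} {p : Fin (n + 1) → ℝ}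

/-- The uniform weights on the pairs of messages. -/
noncomputable def uniformMessages (K₁ K₂ : ℕ) : Fin K₁ × Fin K₂ → ℝ := fun _ => ((K₁ : ℝ) * K₂)⁻¹

theorem uniformMessages_mem_stdSimplex (h₁ : 0 < K₁) (h₂ : 0 < K₂) :
    uniformMessages K₁ K₂ ∈ stdSimplex ℝ (Fin K₁ × Fin K₂) := by
  refine ⟨fun _ => by unfold uniformMessages; positivity, ?_⟩
  have h1 : (K₁ : ℝ) ≠ 0 := by positivity
  have h2 : (K₂ : ℝ) ≠ 0 := by positivity
  simp only [uniformMessages, Finset.sum_const, Finset.card_univ, Fintype.card_prod,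
    Fintype.card_fin, nsmul_eq_mul, Nat.cast_mul]
  field_simp

theorem Code.errorProb_eq (c : Code n m₁ N K₁ K₂) (p : Fin (n + 1) → ℝ) :
    c.errorProb p = ∑ s : Fin N → Fin (n + 1), (∏ t, p (s t)) *
      ∑ ω : Fin K₁ × Fin K₂, uniformMessages K₁ K₂ ω *
        if c.dec₁ (fun t => topBits m₁ (c.enc ω.1 ω.2 t)) = ω.1 ∧
          c.dec₂ (fun t => fadedOutput (s t) (c.enc ω.1 ω.2 t)) = ω.2 then 0 else 1 := by
  classical
  simp only [Code.errorProb, uniformMessages, Fintype.sum_prod_type, Finset.mul_sum]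
  symm
  rw [Finset.sum_comm]
  refine Finset.sum_congr rfl fun w₁ _ => ?_
  rw [Finset.sum_comm]
  refine Finset.sum_congr rfl fun w₂ _ => Finset.sum_congr rfl fun s _ => ?_
  rw [mul_left_comm]

/-- A bound on the rates of a block code in terms of its error probability: Fano's inequality for
both receivers, then `block_bound` with receiver 2's message as side information. -/
theorem Code.rate_bound (c : Code n m₁ N K₁ K₂) (h₁ : 0 < K₁) (h₂ : 0 < K₂) (hmn : m₁ ≤ n)
    (hp : p ∈ stdSimplex ℝ (Fin (n + 1))) {μ : ℝ} (hμ : 0 ≤ μ) :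
    (1 - c.errorProb p) * (Real.logb 2 K₁ + μ * Real.logb 2 K₂) ≤
      N * optValue m₁ p μ + (1 + μ) := by
  classical
  set P := uniformMessages K₁ K₂ with hPdef
  have hP : P ∈ stdSimplex ℝ _ := uniformMessages_mem_stdSimplex h₁ h₂
  set W₁ : Fin K₁ × Fin K₂ → Fin K₁ := Prod.fst
  set W₂ : Fin K₁ × Fin K₂ → Fin K₂ := Prod.snd
  set X : Fin K₁ × Fin K₂ → Fin N → Input n := fun ω => c.enc ω.1 ω.2 with hX
  set Y₁ : Fin K₁ × Fin K₂ → Fin N → TopBits n m₁ := fun ω t => topBits m₁ (X ω t) with hY₁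
  set Y₂ : (Fin N → Fin (n + 1)) → Fin K₁ × Fin K₂ → Fin N → FadedOutput n :=
    fun s ω t => fadedOutput (s t) (X ω t) with hY₂
  set e₁ : ℝ := ∑ ω, P ω * if c.dec₁ (Y₁ ω) = W₁ ω then 0 else 1 with he₁
  set e₂ : (Fin N → Fin (n + 1)) → ℝ := fun s =>
    ∑ ω, P ω * if c.dec₂ (Y₂ s ω) = W₂ ω then 0 else 1 with he₂
  set L₁ := Real.logb 2 K₁ with hL₁
  set L₂ := Real.logb 2 K₂ with hL₂
  have hL₁0 : 0 ≤ L₁ := Real.logb_nonneg one_lt_two (by exact_mod_cast h₁)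
  have hL₂0 : 0 ≤ L₂ := Real.logb_nonneg one_lt_two (by exact_mod_cast h₂)
  have hw : ∀ s : Fin N → Fin (n + 1), 0 ≤ ∏ t, p (s t) := fun s =>
    Finset.prod_nonneg fun t _ => hp.1 _
  -- the entropies of the messages
  have hne : Nonempty (Fin K₁ × Fin K₂) := ⟨(⟨0, h₁⟩, ⟨0, h₂⟩)⟩
  have hW : entropy P (fun ω => (W₁ ω, W₂ ω)) = L₁ + L₂ := by
    have := entropy_uniform_injective (f := fun ω : Fin K₁ × Fin K₂ => ω) Function.injective_id
    rw [Fintype.card_prod, Fintype.card_fin, Fintype.card_fin, Nat.cast_mul,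
      Real.logb_mul (by positivity) (by positivity)] at this
    exact this
  have hW₁ : entropy P W₁ ≤ L₁ := by simpa using entropy_le_logb_card hP W₁
  have hW₂ : entropy P W₂ ≤ L₂ := by simpa using entropy_le_logb_card hP W₂
  have hW12 := entropy_prod_le hP W₁ W₂
  have hW₂e : entropy P W₂ = L₂ := by linarith
  -- receiver 1
  have hR₁ : L₁ ≤ entropy P (fun ω => (W₂ ω, Y₁ ω)) - entropy P W₂ + (1 + e₁ * L₁) := by
    have f1 := fano hP W₁ Y₁ c.dec₁
    rw [Fintype.card_fin] at f1
    have f2 := condEntropy_le_of_determines hP W₁ (g := fun ω => (W₂ ω, Y₁ ω)) (h := Y₁)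
      fun ω ω' h => (Prod.mk.inj h).2
    rw [condEntropy_eq hP.1] at f2
    have f3 : entropy P (fun ω => (W₁ ω, W₂ ω)) ≤ entropy P (fun ω => (W₁ ω, W₂ ω, Y₁ ω)) :=
      entropy_mono hP.1 fun ω ω' h => by
        simp only [Prod.mk.injEq] at h ⊢
        exact ⟨h.1, h.2.1⟩
    linarith
  -- receiver 2, for each fading sequence
  have hR₂ : ∀ s, L₂ ≤ (entropy P W₂ + entropy P (Y₂ s) - entropy P (fun ω => (W₂ ω, Y₂ s ω))) +
      (1 + e₂ s * L₂) := by
    intro s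
    have f1 := fano hP W₂ (Y₂ s) c.dec₂
    rw [Fintype.card_fin, condEntropy_eq hP.1] at f1
    linarith
  have hR₂' : L₂ ≤ ∑ s : Fin N → Fin (n + 1), (∏ t, p (s t)) *
      (entropy P W₂ + entropy P (Y₂ s) - entropy P (fun ω => (W₂ ω, Y₂ s ω))) +
      (1 + (∑ s : Fin N → Fin (n + 1), (∏ t, p (s t)) * e₂ s) * L₂) := by
    calc L₂ = ∑ s : Fin N → Fin (n + 1), (∏ t, p (s t)) * L₂ := by
          rw [← Finset.sum_mul, sum_prod_weights hp, one_mul]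
      _ ≤ ∑ s : Fin N → Fin (n + 1), (∏ t, p (s t)) *
          ((entropy P W₂ + entropy P (Y₂ s) - entropy P (fun ω => (W₂ ω, Y₂ s ω))) +
            (1 + e₂ s * L₂)) :=
          Finset.sum_le_sum fun s _ => mul_le_mul_of_nonneg_left (hR₂ s) (hw s)
      _ = _ := by
          simp only [mul_add, Finset.sum_add_distrib, mul_one, sum_prod_weights hp, Finset.sum_mul,
            mul_assoc]
  -- either receiver errs at most as often as the pair of them
  have hE₁ : e₁ ≤ c.errorProb p := by
    rw [Code.errorProb_eq]
    calc e₁ = ∑ s : Fin N → Fin (n + 1), (∏ t, p (s t)) * e₁ := by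
          rw [← Finset.sum_mul, sum_prod_weights hp, one_mul]
      _ ≤ _ := by
          refine Finset.sum_le_sum fun s _ => mul_le_mul_of_nonneg_left ?_ (hw s)
          refine Finset.sum_le_sum fun ω _ => mul_le_mul_of_nonneg_left ?_ (hP.1 ω)
          by_cases h : c.dec₁ (Y₁ ω) = W₁ ω
          · rw [if_pos h]
            split_ifs <;> norm_num
          · rw [if_neg h, if_neg fun h' => h h'.1]
  have hE₂ : ∑ s : Fin N → Fin (n + 1), (∏ t, p (s t)) * e₂ s ≤ c.errorProb p := by
    rw [Code.errorProb_eq]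
    refine Finset.sum_le_sum fun s _ => mul_le_mul_of_nonneg_left ?_ (hw s)
    refine Finset.sum_le_sum fun ω _ => mul_le_mul_of_nonneg_left ?_ (hP.1 ω)
    by_cases h : c.dec₂ (Y₂ s ω) = W₂ ω
    · rw [if_pos h]
      split_ifs <;> norm_num
    · rw [if_neg h, if_neg fun h' => h h'.2]
  have hB := block_bound hP W₂ X hmn hp hμ
  have g1 := mul_le_mul_of_nonneg_right hE₁ hL₁0
  have g2 := mul_le_mul_of_nonneg_left (mul_le_mul_of_nonneg_right hE₂ hL₂0) hμ
  have g3 := mul_le_mul_of_nonneg_left hR₂' hμ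
  linarith

theorem isClosed_dualRegion (m₁ : ℕ) (p : Fin (n + 1) → ℝ) : IsClosed (dualRegion m₁ p) := by
  have h : dualRegion m₁ p = {R | 0 ≤ R.1} ∩ ({R | 0 ≤ R.2} ∩
      ⋂ μ : ℝ, ⋂ _ : 0 ≤ μ, {R | R.1 + μ * R.2 ≤ optValue m₁ p μ}) := by
    ext R
    simp [dualRegion]
  rw [h]
  exact (isClosed_le continuous_const continuous_fst).inter
    ((isClosed_le continuous_const continuous_snd).inter
      (isClosed_iInter fun μ => isClosed_iInter fun _ =>
        isClosed_le (continuous_fst.add (continuous_const.mul continuous_snd)) continuous_const))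

theorem natCeil_two_rpow_pos (x : ℝ) : 0 < ⌈(2 : ℝ) ^ x⌉₊ :=
  Nat.ceil_pos.2 (Real.rpow_pos_of_pos two_pos _)

theorem le_logb_natCeil (x : ℝ) : x ≤ Real.logb 2 ⌈(2 : ℝ) ^ x⌉₊ := by
  rw [Real.le_logb_iff_rpow_le one_lt_two (by exact_mod_cast natCeil_two_rpow_pos x)]
  exact Nat.le_ceil _

theorem capacityRegion_subset_dualRegion (hmn : m₁ ≤ n) (hp : p ∈ stdSimplex ℝ (Fin (n + 1))) :
    capacityRegion m₁ p ⊆ dualRegion m₁ p := by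
  refine closure_minimal ?_ (isClosed_dualRegion m₁ p)
  rintro R ⟨h1, h2, c, -, hc⟩
  refine ⟨h1, h2, fun μ hμ => ?_⟩
  have hlhs : Tendsto (fun N => (1 - (c N).errorProb p) * (R.1 + μ * R.2)) atTop
      (𝓝 ((1 - 0) * (R.1 + μ * R.2))) := (tendsto_const_nhds.sub hc).mul_const _
  have hrhs : Tendsto (fun N : ℕ => optValue m₁ p μ + (1 + μ) / (N : ℝ)) atTop
      (𝓝 (optValue m₁ p μ + 0)) := tendsto_const_nhds.add (tendsto_const_div_atTop_nhds_zero_nat _)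
  rw [sub_zero, one_mul] at hlhs
  rw [add_zero] at hrhs
  refine le_of_tendsto_of_tendsto hlhs hrhs ?_
  filter_upwards [hc.eventually_lt_const one_pos, eventually_gt_atTop 0] with N hN hN0
  have hN0' : (0 : ℝ) < N := by exact_mod_cast hN0
  have hb := (c N).rate_bound (natCeil_two_rpow_pos _) (natCeil_two_rpow_pos _) hmn hp hμ
  have h3 := le_logb_natCeil (N * R.1)
  have h4 := mul_le_mul_of_nonneg_left (le_logb_natCeil (N * R.2)) hμ
  have h5 : (1 - (c N).errorProb p) * (N * (R.1 + μ * R.2)) ≤ N * optValue m₁ p μ + (1 + μ) := by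
    refine le_trans (mul_le_mul_of_nonneg_left ?_ (sub_nonneg.2 hN.le)) hb
    linarith
  rw [← sub_nonneg] at h5 ⊢
  have h6 : optValue m₁ p μ + (1 + μ) / (N : ℝ) - (1 - (c N).errorProb p) * (R.1 + μ * R.2) =
      (N * optValue m₁ p μ + (1 + μ) - (1 - (c N).errorProb p) * (N * (R.1 + μ * R.2))) / N := by
    field_simp
  rw [h6]
  exact div_nonneg h5 hN0'.le

end Converse

/-! ### Random superposition codes -/

section RandomCoding

variable {n m₁ N K₁ K₂ : ℕ} {p : Fin (n + 1) → ℝ}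

theorem Code.errorProb_nonneg (c : Code n m₁ N K₁ K₂) (hp : ∀ i, 0 ≤ p i) :
    0 ≤ c.errorProb p := by
  refine mul_nonneg (by positivity) (Finset.sum_nonneg fun w₁ _ => Finset.sum_nonneg fun w₂ _ =>
    Finset.sum_nonneg fun s _ => mul_nonneg (Finset.prod_nonneg fun t _ => hp _) ?_)
  split_ifs <;> norm_num

/-- The number of bits assigned to receiver 2 that it sees when `M₂ = i`. -/
def seenBits (m₁ i₀ i : ℕ) : ℕ := min i i₀ + (i - m₁)

/-- Receiver 2 sees the bit `z.2` at time `z.1`, and this bit is assigned to it. -/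
def Seen (m₁ : ℕ) (a : Fin N → ℕ) (s : Fin N → Fin (n + 1)) (z : Fin N × Fin n) : Prop :=
  z.2.val < (s z.1).val ∧ (z.2.val < a z.1 ∨ m₁ ≤ z.2.val)

theorem card_filter_prod (q : Fin N × Fin n → Prop) [DecidablePred q] :
    (Finset.univ.filter q).card =
      ∑ t : Fin N, (Finset.univ.filter fun j : Fin n => q (t, j)).card := by
  simp only [Finset.card_filter, Fintype.sum_prod_type]

theorem card_assigned (a : Fin N → ℕ) (hmn : m₁ ≤ n) :
    Fintype.card {z : Fin N × Fin n // a z.1 ≤ z.2.val ∧ z.2.val < m₁} = ∑ t, (m₁ - a t) := by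
  rw [Fintype.card_subtype, card_filter_prod]
  exact Finset.sum_congr rfl fun t _ => card_filter_fin_Ico (a := a t) hmn

open Classical in
theorem card_seen {a : Fin N → ℕ} (ha : ∀ t, a t ≤ m₁) (s : Fin N → Fin (n + 1)) :
    (Finset.univ.filter (Seen m₁ a s)).card = ∑ t, seenBits m₁ (a t) (s t).val := by
  rw [card_filter_prod]
  refine Finset.sum_congr rfl fun t _ => ?_
  have hs : (s t).val ≤ n := Nat.lt_succ_iff.1 (s t).2
  have h : (Finset.univ.filter fun j : Fin n => Seen m₁ a s (t, j)) =
      (Finset.univ.filter fun j : Fin n => 0 ≤ j.val ∧ j.val < min (s t).val (a t)) ∪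
      (Finset.univ.filter fun j : Fin n => m₁ ≤ j.val ∧ j.val < (s t).val) := by
    ext j
    have hj : Seen m₁ a s (t, j) ↔ j.val < (s t).val ∧ (j.val < a t ∨ m₁ ≤ j.val) := Iff.rfl
    simp only [hj, Finset.mem_filter, Finset.mem_univ, true_and, Finset.mem_union, lt_min_iff]
    omega
  rw [h, Finset.card_union_of_disjoint, card_filter_fin_Ico ((min_le_left _ _).trans hs),
    card_filter_fin_Ico hs, seenBits, Nat.sub_zero]
  rw [Finset.disjoint_left]
  intro j h1 h2
  simp only [Finset.mem_filter, Finset.mem_univ, true_and] at h1 h2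
  have := ha t
  omega

/-- The message `w` of receiver 2 is compatible with the channel output `y` under the codebook
`v`. -/
def Consistent (m₁ : ℕ) (a : Fin N → ℕ) (v : Fin N × Fin n → Fin K₂ → Bool)
    (y : Fin N → FadedOutput n) (w : Fin K₂) : Prop :=
  ∀ (t : Fin N) (j : Fin n) (hj : j.val < (y t).1.val), j.val < a t ∨ m₁ ≤ j.val →
    (y t).2 ⟨j, hj⟩ = v (t, j) w

open Classical in
/-- The superposition code with bits `u` for receiver 1, codebook `v` and decoding by consistency
for receiver 2, and decoder `d` for receiver 1. -/
noncomputable def bitCode (a : Fin N → ℕ) (u : Fin K₁ → Fin N → Input n)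
    (d : (Fin N → TopBits n m₁) → Fin K₁) (h₂ : 0 < K₂) (v : Fin N × Fin n → Fin K₂ → Bool) :
    Code n m₁ N K₁ K₂ where
  enc w₁ w₂ t j := if a t ≤ j.val ∧ j.val < m₁ then u w₁ t j else v (t, j) w₂
  dec₁ := d
  dec₂ y := if h : ∃ w, Consistent m₁ a v y w then h.choose else ⟨0, h₂⟩

theorem bitCode_isSuperposition (a : Fin N → ℕ) (u : Fin K₁ → Fin N → Input n)
    (d : (Fin N → TopBits n m₁) → Fin K₁) (h₂ : 0 < K₂) (v : Fin N × Fin n → Fin K₂ → Bool) :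
    (bitCode a u d h₂ v).IsSuperposition a :=
  ⟨u, fun w t j => v (t, j) w, fun _ _ _ _ => rfl⟩

/-- Receiver 2 errs only if some other codeword has the same bits where it can see them. -/
theorem exists_agree_of_dec₂_ne (a : Fin N → ℕ) (u : Fin K₁ → Fin N → Input n)
    (d : (Fin N → TopBits n m₁) → Fin K₁) (h₂ : 0 < K₂) (v : Fin N × Fin n → Fin K₂ → Bool)
    (s : Fin N → Fin (n + 1)) (w₁ : Fin K₁) (w₂ : Fin K₂)
    (h : (bitCode a u d h₂ v).dec₂
      (fun t => fadedOutput (s t) ((bitCode a u d h₂ v).enc w₁ w₂ t)) ≠ w₂) :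
    ∃ w, w ≠ w₂ ∧ ∀ z, Seen m₁ a s z → v z w₂ = v z w := by
  classical
  have hcons : ∀ w, Consistent m₁ a v
      (fun t => fadedOutput (s t) ((bitCode a u d h₂ v).enc w₁ w₂ t)) w ↔
      ∀ z, Seen m₁ a s z → v z w₂ = v z w := by
    intro w
    have henc : ∀ (t : Fin N) (j : Fin n), j.val < a t ∨ m₁ ≤ j.val →
        (bitCode a u d h₂ v).enc w₁ w₂ t j = v (t, j) w₂ := fun t j hj => by
      refine if_neg ?_
      omega
    constructor
    · rintro h ⟨t, j⟩ ⟨h1, h2⟩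
      exact (henc t j h2).symm.trans (h t j h1 h2)
    · exact fun h t j h1 h2 => (henc t j h2).trans (h (t, j) ⟨h1, h2⟩)
  have hex : ∃ w, Consistent m₁ a v
      (fun t => fadedOutput (s t) ((bitCode a u d h₂ v).enc w₁ w₂ t)) w :=
    ⟨w₂, (hcons w₂).2 fun _ _ => rfl⟩
  refine ⟨_, h, ?_⟩
  have hdec : (bitCode a u d h₂ v).dec₂
      (fun t => fadedOutput (s t) ((bitCode a u d h₂ v).enc w₁ w₂ t)) = hex.choose :=
    dif_pos hex
  rw [hdec]
  exact (hcons _).1 hex.choose_spec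

open Classical in
/-- Two different entries of a uniform bit vector agree half of the time. -/
theorem sum_agree {w w' : Fin K₂} (h : w ≠ w') :
    ∑ c : Fin K₂ → Bool, (if c w = c w' then (1 : ℝ) else 0) =
      (Fintype.card (Fin K₂ → Bool) : ℝ) * 2⁻¹ := by
  -- flipping the entry at `w` exchanges agreement and disagreement
  set e : (Fin K₂ → Bool) → Fin K₂ → Bool := fun c => Function.update c w (!c w)
  have hself : ∀ c, e c w = !c w := fun c => Function.update_self w (!c w) c
  have hne : ∀ c, ∀ k ≠ w, e c k = c k := fun c k hk => Function.update_of_ne hk (!c w) c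
  have hbij : Function.Bijective e := Function.Involutive.bijective fun c => by
    funext k
    by_cases hk : k = w
    · rw [hk, hself, hself, Bool.not_not]
    · rw [hne _ k hk, hne _ k hk]
  have h1 : ∑ c : Fin K₂ → Bool, (if c w = c w' then (1 : ℝ) else 0) =
      ∑ c : Fin K₂ → Bool, (1 - if c w = c w' then (1 : ℝ) else 0) := by
    rw [← hbij.sum_comp]
    refine Finset.sum_congr rfl fun c _ => ?_
    rw [hself, hne c w' h.symm]
    cases c w <;> cases c w' <;> simp
  rw [Finset.sum_sub_distrib] at h1
  simp only [Finset.sum_const, Finset.card_univ, nsmul_eq_mul, mul_one] at h1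
  linarith

open Classical in
theorem sum_codebooks_agree (S : Fin N × Fin n → Prop) {w w' : Fin K₂} (h : w ≠ w') :
    ∑ v : Fin N × Fin n → Fin K₂ → Bool, (if ∀ z, S z → v z w = v z w' then (1 : ℝ) else 0) =
      (Fintype.card (Fin N × Fin n → Fin K₂ → Bool) : ℝ) *
        2⁻¹ ^ (Finset.univ.filter S).card := by
  calc _ = ∑ v : Fin N × Fin n → Fin K₂ → Bool,
        ∏ z, if S z → v z w = v z w' then (1 : ℝ) else 0 := by
        refine Finset.sum_congr rfl fun v _ => ?_
        rw [Finset.prod_ite_zero]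
        simp
    _ = ∏ z, ∑ c : Fin K₂ → Bool, if S z → c w = c w' then (1 : ℝ) else 0 := by
        rw [Finset.prod_univ_sum, Fintype.piFinset_univ]
    _ = ∏ z, ((Fintype.card (Fin K₂ → Bool) : ℝ) * if S z then 2⁻¹ else 1) := by
        refine Finset.prod_congr rfl fun z _ => ?_
        by_cases hz : S z
        · simp only [hz, true_imp_iff, if_true]
          exact sum_agree h
        · simp [hz]
    _ = _ := by
        rw [Finset.prod_mul_distrib, Finset.prod_const, ← Finset.prod_filter, Finset.prod_const,
          Finset.card_univ, Fintype.card_fun (α := Fin N × Fin n), Nat.cast_pow]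

theorem min_one_le_rpow {x ρ : ℝ} (hx : 0 ≤ x) (h0 : 0 < ρ) (h1 : ρ ≤ 1) : min 1 x ≤ x ^ ρ := by
  rcases le_total x 1 with h | h
  · refine (min_le_right _ _).trans ?_
    simpa using Real.rpow_le_rpow_of_exponent_ge' hx h h0.le h1
  · exact (min_le_left _ _).trans (Real.one_le_rpow h h0.le)

open Classical in
/-- The union bound over the wrong messages, weakened to Gallager's form with a parameter `ρ`, which
factorizes over time. -/
theorem sum_codebooks_exists_agree (S : Fin N × Fin n → Prop) (w₂ : Fin K₂) {ρ : ℝ} (h0 : 0 < ρ)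
    (h1 : ρ ≤ 1) :
    ∑ v : Fin N × Fin n → Fin K₂ → Bool,
        (if ∃ w, w ≠ w₂ ∧ ∀ z, S z → v z w₂ = v z w then (1 : ℝ) else 0) ≤
      (Fintype.card (Fin N × Fin n → Fin K₂ → Bool) : ℝ) *
        (((K₂ : ℝ) - 1) * 2⁻¹ ^ (Finset.univ.filter S).card) ^ ρ := by
  have hK : (1 : ℝ) ≤ K₂ := by exact_mod_cast (Nat.zero_le _).trans_lt w₂.2
  refine le_trans ?_ (mul_le_mul_of_nonneg_left (min_one_le_rpow (mul_nonneg (sub_nonneg.2 hK)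
    (by positivity)) h0 h1) (Nat.cast_nonneg _))
  rw [mul_min_of_nonneg _ _ (Nat.cast_nonneg _), le_min_iff]
  constructor
  · refine (Finset.sum_le_sum fun v _ => (?_ : _ ≤ (1 : ℝ))).trans ?_
    · split_ifs <;> norm_num
    · simp
  · calc _ ≤ ∑ v : Fin N × Fin n → Fin K₂ → Bool, ∑ w ∈ Finset.univ.erase w₂,
          (if ∀ z, S z → v z w₂ = v z w then (1 : ℝ) else 0) := by
          refine Finset.sum_le_sum fun v _ => ?_
          have hnn : ∀ w ∈ Finset.univ.erase w₂,
              (0 : ℝ) ≤ if ∀ z, S z → v z w₂ = v z w then (1 : ℝ) else 0 := fun w _ => by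
            split_ifs <;> norm_num
          by_cases h : ∃ w, w ≠ w₂ ∧ ∀ z, S z → v z w₂ = v z w
          · rw [if_pos h]
            obtain ⟨w, hw, hz⟩ := h
            refine le_trans ?_ (Finset.single_le_sum hnn
              (Finset.mem_erase.2 ⟨hw, Finset.mem_univ w⟩))
            rw [if_pos hz]
          · rw [if_neg h]
            exact Finset.sum_nonneg hnn
      _ = ∑ w ∈ Finset.univ.erase w₂, (Fintype.card (Fin N × Fin n → Fin K₂ → Bool) : ℝ) *
            2⁻¹ ^ (Finset.univ.filter S).card := by
          rw [Finset.sum_comm]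
          exact Finset.sum_congr rfl fun w hw =>
            sum_codebooks_agree S (Finset.ne_of_mem_erase hw).symm
      _ = _ := by
          rw [Finset.sum_const, Finset.card_erase_of_mem (Finset.mem_univ _), Finset.card_univ,
            Fintype.card_fin, nsmul_eq_mul, Nat.cast_sub (by exact_mod_cast hK), Nat.cast_one]
          ring

/-- Random coding: uncoded bits for receiver 1, a uniformly random codebook for receiver 2. -/
theorem exists_superposition_code (hp : p ∈ stdSimplex ℝ (Fin (n + 1))) (hmn : m₁ ≤ n)
    {a : Fin N → ℕ} (ha : ∀ t, a t ≤ m₁) (h₁ : 0 < K₁) (h₂ : 0 < K₂)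
    (hK₁ : K₁ ≤ 2 ^ ∑ t, (m₁ - a t)) {ρ : ℝ} (hρ0 : 0 < ρ) (hρ1 : ρ ≤ 1) :
    ∃ c : Code n m₁ N K₁ K₂, c.IsSuperposition a ∧ c.errorProb p ≤ ((K₂ : ℝ) - 1) ^ ρ *
      ∏ t, ∑ i : Fin (n + 1), p i * (2 : ℝ) ^ (-(ρ * seenBits m₁ (a t) i.val)) := by
  classical
  obtain ⟨ι⟩ : Nonempty (Fin K₁ ↪
      ({z : Fin N × Fin n // a z.1 ≤ z.2.val ∧ z.2.val < m₁} → Bool)) := by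
    refine Function.Embedding.nonempty_of_card_le ?_
    rwa [Fintype.card_fin, Fintype.card_fun, Fintype.card_bool, card_assigned a hmn]
  have : Nonempty (Fin K₁) := ⟨⟨0, h₁⟩⟩
  set u : Fin K₁ → Fin N → Input n := fun w t j =>
    if h : a t ≤ j.val ∧ j.val < m₁ then ι w ⟨(t, j), h⟩ else false with hu
  set d : (Fin N → TopBits n m₁) → Fin K₁ := fun y =>
    Function.invFun ι (fun z => y z.1.1 ⟨z.1.2, z.2.2⟩) with hd
  have hdec₁ : ∀ (v : Fin N × Fin n → Fin K₂ → Bool) w₁ w₂, (bitCode a u d h₂ v).dec₁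
      (fun t => topBits m₁ ((bitCode a u d h₂ v).enc w₁ w₂ t)) = w₁ := by
    intro v w₁ w₂
    refine Eq.trans (congrArg (Function.invFun ι) (funext fun z => ?_))
      (Function.leftInverse_invFun ι.injective w₁)
    simp only [topBits, bitCode, if_pos z.2, hu, dif_pos z.2]
  have hP := uniformMessages_mem_stdSimplex h₁ h₂
  set B : ℝ := ((K₂ : ℝ) - 1) ^ ρ *
    ∏ t, ∑ i : Fin (n + 1), p i * (2 : ℝ) ^ (-(ρ * seenBits m₁ (a t) i.val)) with hB
  have hK : (0 : ℝ) ≤ (K₂ : ℝ) - 1 := sub_nonneg.2 (by exact_mod_cast h₂)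
  have hBs : ∑ s : Fin N → Fin (n + 1), (∏ t, p (s t)) *
      (((K₂ : ℝ) - 1) * 2⁻¹ ^ (Finset.univ.filter (Seen m₁ a s)).card) ^ ρ = B := by
    rw [hB, ← sum_prod_eq_prod_sum fun t i => p i * (2 : ℝ) ^ (-(ρ * seenBits m₁ (a t) i.val)),
      Finset.mul_sum]
    refine Finset.sum_congr rfl fun s _ => ?_
    rw [Finset.prod_mul_distrib, mul_left_comm, Real.mul_rpow hK (by positivity), card_seen ha,
      ← Finset.prod_pow_eq_pow_sum, ← Real.finsetProd_rpow _ _ fun _ _ => by positivity]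
    congr 2
    refine Finset.prod_congr rfl fun t _ => ?_
    rw [Real.rpow_neg two_pos.le, mul_comm ρ, Real.rpow_mul two_pos.le, Real.rpow_natCast, inv_pow,
      Real.inv_rpow (by positivity)]
  -- the error probability, averaged over the codebooks
  have havg : ∑ v : Fin N × Fin n → Fin K₂ → Bool, (bitCode a u d h₂ v).errorProb p ≤
      ∑ _v : Fin N × Fin n → Fin K₂ → Bool, B := by
    have hv : ∀ v : Fin N × Fin n → Fin K₂ → Bool, (bitCode a u d h₂ v).errorProb p ≤
        ∑ s : Fin N → Fin (n + 1), (∏ t, p (s t)) * ∑ ω, uniformMessages K₁ K₂ ω *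
          if ∃ w, w ≠ ω.2 ∧ ∀ z, Seen m₁ a s z → v z ω.2 = v z w then 1 else 0 := by
      intro v
      rw [Code.errorProb_eq]
      refine Finset.sum_le_sum fun s _ => mul_le_mul_of_nonneg_left
        (Finset.sum_le_sum fun ω _ => mul_le_mul_of_nonneg_left ?_ (hP.1 ω))
        (Finset.prod_nonneg fun t _ => hp.1 _)
      by_cases h : (bitCode a u d h₂ v).dec₂
          (fun t => fadedOutput (s t) ((bitCode a u d h₂ v).enc ω.1 ω.2 t)) = ω.2
      · rw [if_pos ⟨hdec₁ v ω.1 ω.2, h⟩]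
        split_ifs <;> norm_num
      · rw [if_pos (exists_agree_of_dec₂_ne a u d h₂ v s ω.1 ω.2 h)]
        split_ifs <;> norm_num
    refine (Finset.sum_le_sum fun v _ => hv v).trans ?_
    rw [Finset.sum_comm, Finset.sum_const, Finset.card_univ, nsmul_eq_mul, ← hBs, Finset.mul_sum]
    refine Finset.sum_le_sum fun s _ => ?_
    rw [← Finset.mul_sum, mul_left_comm, Finset.sum_comm]
    refine mul_le_mul_of_nonneg_left ?_ (Finset.prod_nonneg fun t _ => hp.1 _)
    calc _ ≤ ∑ ω, uniformMessages K₁ K₂ ω *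
          ((Fintype.card (Fin N × Fin n → Fin K₂ → Bool) : ℝ) *
            (((K₂ : ℝ) - 1) * 2⁻¹ ^ (Finset.univ.filter (Seen m₁ a s)).card) ^ ρ) := by
          refine Finset.sum_le_sum fun ω _ => ?_
          rw [← Finset.mul_sum]
          exact mul_le_mul_of_nonneg_left (sum_codebooks_exists_agree _ ω.2 hρ0 hρ1) (hP.1 ω)
      _ = _ := by rw [← Finset.sum_mul, hP.2, one_mul]
  obtain ⟨v, -, hv⟩ := Finset.exists_le_of_sum_le Finset.univ_nonempty havg
  exact ⟨_, bitCode_isSuperposition a u d h₂ v, hv⟩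

end RandomCoding

/-! ### Achievability -/

section Achievability

variable {n m₁ : ℕ} {p : Fin (n + 1) → ℝ}

/-- One factor of the error bound: for small `ρ`, the mean of `2 ^ (-ρ c)` is close to
`1 - ρ log 2 E[c]`. -/
theorem sum_mul_two_rpow_le {i₀ : ℕ} (hp : p ∈ stdSimplex ℝ (Fin (n + 1))) (hi : i₀ ≤ m₁)
    {ρ : ℝ} (hρ : 0 ≤ ρ) (hρn : ρ * n ≤ 1) :
    ∑ i : Fin (n + 1), p i * (2 : ℝ) ^ (-(ρ * seenBits m₁ i₀ i.val)) ≤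
      Real.exp (-(ρ * Real.log 2 * rate₂ m₁ p i₀) + (ρ * n) ^ 2) := by
  have hlog0 : 0 < Real.log 2 := Real.log_pos one_lt_two
  have hlog1 : Real.log 2 ≤ 1 := by have := Real.log_two_lt_d9; linarith
  have hterm : ∀ i : Fin (n + 1), (2 : ℝ) ^ (-(ρ * seenBits m₁ i₀ i.val)) ≤
      1 - ρ * Real.log 2 * seenBits m₁ i₀ i.val + (ρ * n) ^ 2 := by
    intro i
    have hc : (seenBits m₁ i₀ i.val : ℝ) ≤ n := by
      have hin := Nat.lt_succ_iff.1 i.2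
      exact_mod_cast (show seenBits m₁ i₀ i.val ≤ n by unfold seenBits; omega)
    set y := ρ * Real.log 2 * seenBits m₁ i₀ i.val with hy
    have hy0 : 0 ≤ y := by positivity
    have hyn : y ≤ ρ * n := by
      calc y = ρ * (Real.log 2 * seenBits m₁ i₀ i.val) := mul_assoc _ _ _
        _ ≤ ρ * (1 * n) := by gcongr
        _ = ρ * n := by rw [one_mul]
    have h1 := Real.abs_exp_sub_one_sub_id_le (x := -y) (by
      rw [abs_neg, abs_of_nonneg hy0]
      exact hyn.trans hρn)
    have h2 : (2 : ℝ) ^ (-(ρ * seenBits m₁ i₀ i.val)) = Real.exp (-y) := by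
      rw [Real.rpow_def_of_pos two_pos, hy]
      ring_nf
    have h3 : y ^ 2 ≤ (ρ * n) ^ 2 := by gcongr
    have h4 := (abs_le.1 h1).2
    rw [neg_sq] at h4
    rw [h2]
    linarith
  have hrate : ∑ i : Fin (n + 1), p i * (seenBits m₁ i₀ i.val : ℝ) = rate₂ m₁ p i₀ := rfl
  calc _ ≤ ∑ i : Fin (n + 1), p i * (1 - ρ * Real.log 2 * seenBits m₁ i₀ i.val + (ρ * n) ^ 2) :=
        Finset.sum_le_sum fun i _ => mul_le_mul_of_nonneg_left (hterm i) (hp.1 i)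
    _ = (∑ i, p i) * (1 + (ρ * n) ^ 2) -
        ρ * Real.log 2 * ∑ i : Fin (n + 1), p i * (seenBits m₁ i₀ i.val : ℝ) := by
        rw [Finset.sum_mul, Finset.mul_sum, ← Finset.sum_sub_distrib]
        exact Finset.sum_congr rfl fun i _ => by ring
    _ = -(ρ * Real.log 2 * rate₂ m₁ p i₀) + (ρ * n) ^ 2 + 1 := by
        rw [hp.2, hrate]
        ring
    _ ≤ _ := Real.add_one_le_exp _

theorem exists_isSuperposition {N K₁ K₂ : ℕ} (a : Fin N → ℕ) (h₁ : 0 < K₁) (h₂ : 0 < K₂) :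
    ∃ c : Code n m₁ N K₁ K₂, c.IsSuperposition a :=
  ⟨⟨fun _ _ _ _ => false, fun _ => ⟨0, h₁⟩, fun _ => ⟨0, h₂⟩⟩, fun _ _ _ => false,
    fun _ _ _ => false, fun _ _ _ _ => by simp⟩

/-- Rates below those offered by a schedule of bit assignments are achieved by superposition codes
that follow the schedule. -/
theorem exists_codes_of_schedule (hp : p ∈ stdSimplex ℝ (Fin (n + 1))) (hm : m₁ ≤ n) (hn : 0 < n)
    {R₁ R₂ : ℝ} (a : ∀ N, Fin N → ℕ) (ha : ∀ N t, a N t ≤ m₁)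
    (hR₁ : ∀ᶠ N : ℕ in atTop, (N : ℝ) * R₁ ≤ ∑ t, ((m₁ : ℝ) - a N t))
    (hR₂ : R₂ = 0 ∨ ∃ δ > 0, ∀ᶠ N : ℕ in atTop, (N : ℝ) * (R₂ + δ) ≤ ∑ t, rate₂ m₁ p (a N t)) :
    ∃ c : ∀ N : ℕ, Code n m₁ N ⌈(2 : ℝ) ^ ((N : ℝ) * R₁)⌉₊ ⌈(2 : ℝ) ^ ((N : ℝ) * R₂)⌉₊,
      (∀ N, (c N).IsSuperposition (a N)) ∧ Tendsto (fun N => (c N).errorProb p) atTop (𝓝 0) := by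
  have hcodes : ∀ ρ : ℝ, 0 < ρ → ρ ≤ 1 → ∃ c : ∀ N : ℕ,
      Code n m₁ N ⌈(2 : ℝ) ^ ((N : ℝ) * R₁)⌉₊ ⌈(2 : ℝ) ^ ((N : ℝ) * R₂)⌉₊,
      (∀ N, (c N).IsSuperposition (a N)) ∧ ∀ᶠ N : ℕ in atTop, (c N).errorProb p ≤
        ((⌈(2 : ℝ) ^ ((N : ℝ) * R₂)⌉₊ : ℝ) - 1) ^ ρ *
          ∏ t, ∑ i : Fin (n + 1), p i * (2 : ℝ) ^ (-(ρ * seenBits m₁ (a N t) i.val)) := by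
    intro ρ hρ0 hρ1
    have h : ∀ N : ℕ, ∃ c : Code n m₁ N ⌈(2 : ℝ) ^ ((N : ℝ) * R₁)⌉₊ ⌈(2 : ℝ) ^ ((N : ℝ) * R₂)⌉₊,
        c.IsSuperposition (a N) ∧ ((N : ℝ) * R₁ ≤ ∑ t, ((m₁ : ℝ) - a N t) → c.errorProb p ≤
        ((⌈(2 : ℝ) ^ ((N : ℝ) * R₂)⌉₊ : ℝ) - 1) ^ ρ *
          ∏ t, ∑ i : Fin (n + 1), p i * (2 : ℝ) ^ (-(ρ * seenBits m₁ (a N t) i.val))) := by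
      intro N
      by_cases hN : (N : ℝ) * R₁ ≤ ∑ t, ((m₁ : ℝ) - a N t)
      · have hK : ⌈(2 : ℝ) ^ ((N : ℝ) * R₁)⌉₊ ≤ 2 ^ ∑ t, (m₁ - a N t) := by
          rw [Nat.ceil_le]
          push_cast
          rw [← Real.rpow_natCast]
          refine Real.rpow_le_rpow_of_exponent_le one_le_two (hN.trans_eq ?_)
          push_cast
          exact Finset.sum_congr rfl fun t _ => (Nat.cast_sub (ha N t)).symm
        obtain ⟨c, h1, h2⟩ := exists_superposition_code hp hm (ha N) (natCeil_two_rpow_pos _)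
          (natCeil_two_rpow_pos ((N : ℝ) * R₂)) hK hρ0 hρ1
        exact ⟨c, h1, fun _ => h2⟩
      · obtain ⟨c, hc⟩ := exists_isSuperposition (n := n) (m₁ := m₁) (a N)
          (natCeil_two_rpow_pos ((N : ℝ) * R₁)) (natCeil_two_rpow_pos ((N : ℝ) * R₂))
        exact ⟨c, hc, fun h => absurd h hN⟩
    choose c hc1 hc2 using h
    exact ⟨c, hc1, hR₁.mono hc2⟩
  rcases hR₂ with rfl | ⟨δ, hδ, hR₂⟩
  · -- a single message for receiver 2 is decoded without error
    obtain ⟨c, hc1, hc2⟩ := hcodes 1 one_pos le_rfl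
    refine ⟨c, hc1, tendsto_of_tendsto_of_tendsto_of_le_of_le' tendsto_const_nhds
      tendsto_const_nhds (Eventually.of_forall fun N => (c N).errorProb_nonneg hp.1)
      (hc2.mono fun N hN => hN.trans_eq ?_)⟩
    simp
  · have hlog0 : 0 < Real.log 2 := Real.log_pos one_lt_two
    have hn' : (0 : ℝ) < n := by exact_mod_cast hn
    have hn1 : (1 : ℝ) ≤ n := by exact_mod_cast hn
    -- small enough for the quadratic term of the exponent to take at most half of the linear one
    set ρ : ℝ := min (1 / n) (δ * Real.log 2 / (2 * n ^ 2)) with hρ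
    have hρ0 : 0 < ρ := lt_min (by positivity) (by positivity)
    have hρn : ρ * n ≤ 1 := (le_div_iff₀ hn').1 (min_le_left _ _)
    have hρ1 : ρ ≤ 1 := (le_mul_of_one_le_right hρ0.le hn1).trans hρn
    have hρq : (ρ * n) ^ 2 ≤ ρ * (δ * Real.log 2 / 2) := by
      have h1 : ρ * (2 * n ^ 2) ≤ δ * Real.log 2 :=
        (le_div_iff₀ (by positivity)).1 (min_le_right _ _)
      have h2 := mul_le_mul_of_nonneg_left h1 hρ0.le
      nlinarith
    obtain ⟨c, hc1, hc2⟩ := hcodes ρ hρ0 hρ1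
    set κ : ℝ := ρ * (δ * Real.log 2 / 2) with hκ
    have hκ0 : 0 < κ := by positivity
    have hlim : Tendsto (fun N : ℕ => Real.exp (-(N * κ))) atTop (𝓝 0) :=
      Real.tendsto_exp_neg_atTop_nhds_zero.comp
        (tendsto_natCast_atTop_atTop.atTop_mul_const hκ0)
    refine ⟨c, hc1, tendsto_of_tendsto_of_tendsto_of_le_of_le' tendsto_const_nhds hlim
      (Eventually.of_forall fun N => (c N).errorProb_nonneg hp.1) ?_⟩
    filter_upwards [hc2, hR₂] with N hN1 hN2
    refine hN1.trans ?_
    have hK0 : (0 : ℝ) ≤ (⌈(2 : ℝ) ^ ((N : ℝ) * R₂)⌉₊ : ℝ) - 1 :=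
      sub_nonneg.2 (by exact_mod_cast natCeil_two_rpow_pos _)
    have hK : ((⌈(2 : ℝ) ^ ((N : ℝ) * R₂)⌉₊ : ℝ) - 1) ^ ρ ≤
        Real.exp (ρ * Real.log 2 * (N * R₂)) := by
      have h1 : (⌈(2 : ℝ) ^ ((N : ℝ) * R₂)⌉₊ : ℝ) - 1 ≤ (2 : ℝ) ^ ((N : ℝ) * R₂) :=
        sub_le_iff_le_add.2 (Nat.ceil_lt_add_one (by positivity)).le
      refine (Real.rpow_le_rpow hK0 h1 hρ0.le).trans_eq ?_
      rw [← Real.rpow_mul two_pos.le, Real.rpow_def_of_pos two_pos]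
      ring_nf
    have hprod : ∏ t, ∑ i : Fin (n + 1), p i * (2 : ℝ) ^ (-(ρ * seenBits m₁ (a N t) i.val)) ≤
        Real.exp (-(ρ * Real.log 2 * ∑ t, rate₂ m₁ p (a N t)) + N * (ρ * n) ^ 2) := by
      refine (Finset.prod_le_prod (fun t _ => Finset.sum_nonneg fun i _ =>
        mul_nonneg (hp.1 i) (by positivity)) fun t _ =>
        sum_mul_two_rpow_le hp (ha N t) hρ0.le hρn).trans_eq ?_
      rw [← Real.exp_sum, Finset.sum_add_distrib, Finset.sum_neg_distrib, ← Finset.mul_sum]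
      simp
    calc _ ≤ Real.exp (ρ * Real.log 2 * (N * R₂)) *
          Real.exp (-(ρ * Real.log 2 * ∑ t, rate₂ m₁ p (a N t)) + N * (ρ * n) ^ 2) :=
          mul_le_mul hK hprod (Finset.prod_nonneg fun t _ => Finset.sum_nonneg fun i _ =>
            mul_nonneg (hp.1 i) (by positivity)) (Real.exp_pos _).le
      _ ≤ _ := by
          rw [← Real.exp_add, Real.exp_le_exp]
          have h1 := mul_le_mul_of_nonneg_left hN2 (mul_pos hρ0 hlog0).le
          have h2 := mul_le_mul_of_nonneg_left hρq (Nat.cast_nonneg (α := ℝ) N)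
          rw [hκ] at *
          nlinarith

theorem mem_closure_of_smul_mem {S : Set (ℝ × ℝ)} {R : ℝ × ℝ}
    (h : ∀ θ : ℝ, 0 < θ → θ < 1 → θ • R ∈ S) : R ∈ closure S := by
  have hlim : Tendsto (fun θ : ℝ => θ • R) (𝓝[<] 1) (𝓝 R) := by
    have : Tendsto (fun θ : ℝ => θ • R) (𝓝 1) (𝓝 ((1 : ℝ) • R)) :=
      (continuous_id.smul continuous_const).tendsto 1
    rw [one_smul] at this
    exact this.mono_left nhdsWithin_le_nhds
  refine mem_closure_of_tendsto hlim ?_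
  filter_upwards [self_mem_nhdsWithin, mem_nhdsWithin_of_mem_nhds (lt_mem_nhds one_pos)] with θ h1 h0
  exact h θ h0 h1

theorem rectangle_subset_fixedSuperpositionRegion (hp : p ∈ stdSimplex ℝ (Fin (n + 1)))
    (hm : m₁ ≤ n) (hn : 0 < n) {i₀ : ℕ} (hi : i₀ ≤ m₁) :
    rectangle m₁ p i₀ ⊆ fixedSuperpositionRegion m₁ p i₀ := by
  rintro R ⟨h1, h2, h3, h4⟩
  refine mem_closure_of_smul_mem fun θ hθ0 hθ1 => ⟨mul_nonneg hθ0.le h1, mul_nonneg hθ0.le h3, ?_⟩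
  refine exists_codes_of_schedule hp hm hn (fun _ _ => i₀) (fun _ _ => hi)
    (Eventually.of_forall fun N => ?_) ?_
  · have : θ * R.1 ≤ (m₁ : ℝ) - i₀ := (mul_le_of_le_one_left h1 hθ1.le).trans h2
    simpa [mul_sub] using mul_le_mul_of_nonneg_left this (Nat.cast_nonneg (α := ℝ) N)
  · rcases h3.eq_or_lt with h | h
    · exact Or.inl (show θ * R.2 = 0 by rw [← h, mul_zero])
    · refine Or.inr ⟨(1 - θ) * R.2, mul_pos (sub_pos.2 hθ1) h, Eventually.of_forall fun N => ?_⟩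
      have : (θ • R).2 + (1 - θ) * R.2 ≤ rate₂ m₁ p i₀ :=
        le_of_eq_of_le (by simp only [Prod.smul_snd, smul_eq_mul]; ring) h4
      simpa using mul_le_mul_of_nonneg_left this (Nat.cast_nonneg (α := ℝ) N)

/-- A schedule that uses the `i`-th option during (almost) a fraction `w i` of the time. -/
theorem exists_schedule {k : ℕ} {w : Fin (k + 1) → ℝ} (hw : w ∈ stdSimplex ℝ (Fin (k + 1)))
    (N : ℕ) : ∃ a : Fin N → Fin (k + 1), ∀ f : Fin (k + 1) → ℝ, (∀ i, 0 ≤ f i) →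
      N * ∑ i, w i * f i - ∑ i, f i ≤ ∑ t, f (a t) := by
  classical
  -- reserve `⌊N w i⌋` of the `N` time slots for option `i`; the other slots are used arbitrarily
  obtain ⟨e⟩ : Nonempty ((Σ i : Fin (k + 1), Fin ⌊N * w i⌋₊) ↪ Fin N) := by
    refine Function.Embedding.nonempty_of_card_le ?_
    rw [Fintype.card_sigma, Fintype.card_fin]
    simp only [Fintype.card_fin]
    have : ((∑ i, ⌊N * w i⌋₊ : ℕ) : ℝ) ≤ N := by
      push_cast
      calc ∑ i, (⌊N * w i⌋₊ : ℝ) ≤ ∑ i, N * w i := Finset.sum_le_sum fun i _ =>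
            Nat.floor_le (mul_nonneg (Nat.cast_nonneg _) (hw.1 i))
        _ = N := by rw [← Finset.mul_sum, hw.2, mul_one]
    exact_mod_cast this
  refine ⟨fun t => if h : ∃ z, e z = t then h.choose.1 else 0, fun f hf => ?_⟩
  have ha : ∀ z, (if h : ∃ z', e z' = e z then h.choose.1 else 0) = z.1 := fun z => by
    have h : ∃ z', e z' = e z := ⟨z, rfl⟩
    rw [dif_pos h, e.injective h.choose_spec]
  calc (N : ℝ) * ∑ i, w i * f i - ∑ i, f i = ∑ i, (N * w i - 1) * f i := by
        rw [Finset.mul_sum, ← Finset.sum_sub_distrib]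
        exact Finset.sum_congr rfl fun i _ => by ring
    _ ≤ ∑ i, (⌊N * w i⌋₊ : ℝ) * f i := Finset.sum_le_sum fun i _ =>
        mul_le_mul_of_nonneg_right (Nat.sub_one_lt_floor _).le (hf i)
    _ = ∑ z : Σ i : Fin (k + 1), Fin ⌊N * w i⌋₊, f z.1 := by
        rw [Fintype.sum_sigma]
        simp
    _ = ∑ z, f (if h : ∃ z', e z' = e z then h.choose.1 else 0) :=
        Finset.sum_congr rfl fun z _ => by rw [ha]
    _ = ∑ t ∈ Finset.univ.map e, f (if h : ∃ z, e z = t then h.choose.1 else 0) := by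
        rw [Finset.sum_map]
    _ ≤ _ := Finset.sum_le_sum_of_subset_of_nonneg (Finset.subset_univ _) fun t _ _ => hf _

theorem eventually_natCast_mul_le {x y C : ℝ} (h : x < y) :
    ∀ᶠ N : ℕ in atTop, (N : ℝ) * x ≤ N * y - C := by
  have hlim : Tendsto (fun N : ℕ => (N : ℝ) * (y - x)) atTop atTop :=
    tendsto_natCast_atTop_atTop.atTop_mul_const (sub_pos.2 h)
  filter_upwards [hlim.eventually_ge_atTop C] with N hN
  linarith

theorem explicitRegion_subset_superpositionRegion (hp : p ∈ stdSimplex ℝ (Fin (n + 1)))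
    (hm : m₁ ≤ n) (hn : 0 < n) : explicitRegion m₁ p ⊆ superpositionRegion m₁ p := by
  intro R hR
  obtain ⟨h1, h2, w, hw, hR₁, hR₂⟩ := exists_weights_of_mem_explicitRegion hR
  choose a ha using exists_schedule hw
  have hle : ∀ i : Fin (m₁ + 1), i.val ≤ m₁ := fun i => Nat.lt_succ_iff.1 i.2
  have hf₁ : ∀ i : Fin (m₁ + 1), (0 : ℝ) ≤ (m₁ : ℝ) - i.val := fun i =>
    sub_nonneg.2 (by exact_mod_cast hle i)
  refine mem_closure_of_smul_mem fun θ hθ0 hθ1 => ⟨mul_nonneg hθ0.le h1, mul_nonneg hθ0.le h2, ?_⟩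
  have e₁ : ∀ᶠ N : ℕ in atTop, (N : ℝ) * (θ • R).1 ≤ ∑ t, ((m₁ : ℝ) - (a N t).val) := by
    rcases h1.eq_or_lt with h | h
    · refine Eventually.of_forall fun N => ?_
      rw [Prod.smul_fst, ← h, smul_zero, mul_zero]
      exact Finset.sum_nonneg fun t _ => hf₁ _
    · have hlt : (θ • R).1 < ∑ i, w i * ((m₁ : ℝ) - i.val) :=
        (mul_lt_of_lt_one_left h hθ1).trans_le hR₁
      filter_upwards [eventually_natCast_mul_le (C := ∑ i : Fin (m₁ + 1), ((m₁ : ℝ) - i.val)) hlt]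
        with N hN
      exact hN.trans (ha N _ hf₁)
  have e₂ : (θ • R).2 = 0 ∨ ∃ δ > 0, ∀ᶠ N : ℕ in atTop,
      (N : ℝ) * ((θ • R).2 + δ) ≤ ∑ t, rate₂ m₁ p (a N t).val := by
    rcases h2.eq_or_lt with h | h
    · exact Or.inl (show θ * R.2 = 0 by rw [← h, mul_zero])
    · have hlt : (θ • R).2 < R.2 := mul_lt_of_lt_one_left h hθ1
      refine Or.inr ⟨(R.2 - (θ • R).2) / 2, by linarith, ?_⟩
      filter_upwards [eventually_natCast_mul_le (C := ∑ i : Fin (m₁ + 1), rate₂ m₁ p i.val)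
        (show (θ • R).2 + (R.2 - (θ • R).2) / 2 < ∑ i, w i * rate₂ m₁ p i.val by linarith)]
        with N hN
      exact hN.trans (ha N (fun i => rate₂ m₁ p i.val) fun i => rate₂_nonneg hp m₁ _)
  obtain ⟨c, hc1, hc2⟩ := exists_codes_of_schedule hp hm hn (fun N t => (a N t).val)
    (fun N t => hle _) e₁ e₂
  exact ⟨c, fun N => ⟨_, fun t => hle _, hc1 N⟩, hc2⟩

theorem superpositionRegion_subset_capacityRegion (m₁ : ℕ) (p : Fin (n + 1) → ℝ) :
    superpositionRegion m₁ p ⊆ capacityRegion m₁ p := by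
  refine closure_mono ?_
  rintro R ⟨h1, h2, c, -, hc⟩
  exact ⟨h1, h2, c, fun _ => trivial, hc⟩

end Achievability

end FadingBC

theorem mainTheorem3 (n m₁ : ℕ) (hm : 0 < m₁) (hmn : m₁ < n)
    (p : Fin (n + 1) → ℝ) (hp : p ∈ stdSimplex ℝ (Fin (n + 1))) :
    -- the optimization problem behind the Körner–Marton bound
    (∀ μ : ℝ, 0 ≤ μ →
      -- its value
      IsGreatest {r : ℝ | ∃ (V : Type) (_ : Fintype V) (P : V × FadingBC.Input n → ℝ),
        P ∈ stdSimplex ℝ (V × FadingBC.Input n) ∧ r = FadingBC.objective m₁ p μ P}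
        (FadingBC.optValue m₁ p μ) ∧
      -- independent bits are optimal, with the bits above the threshold and the bits never seen
      -- by receiver 1 in `V`
      (∃! i₀ : ℕ, FadingBC.IsThreshold m₁ p μ i₀) ∧
      (∀ i₀ : ℕ, FadingBC.IsThreshold m₁ p μ i₀ →
        FadingBC.objective m₁ p μ (FadingBC.bitLaw n m₁ i₀) = FadingBC.optValue m₁ p μ) ∧
      -- what every optimal choice has to satisfy
      (∀ (V : Type) [Fintype V] (P : V × FadingBC.Input n → ℝ),
        P ∈ stdSimplex ℝ (V × FadingBC.Input n) →
        FadingBC.objective m₁ p μ P = FadingBC.optValue m₁ p μ →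
        ∀ j : Fin n,
          (j.val < m₁ ∨ 0 < μ * FadingBC.tail p (j.val + 1) →
            FadingBC.condEntropy (FadingBC.withFading p P) (fun ω => FadingBC.rvX ω j)
              (fun ω => FadingBC.topBits j.val (FadingBC.rvX ω)) = 1) ∧
          (j.val < m₁ → 1 < μ * FadingBC.tail p (j.val + 1) →
            FadingBC.condEntropy (FadingBC.withFading p P) (fun ω => FadingBC.rvX ω j)
              FadingBC.rvV = 0) ∧
          (j.val < m₁ → μ * FadingBC.tail p (j.val + 1) < 1 →
            FadingBC.condEntropy (FadingBC.withFading p P) (fun ω => FadingBC.rvX ω j)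
              (fun ω => (FadingBC.rvV ω, FadingBC.topBits j.val (FadingBC.rvX ω))) = 1) ∧
          (m₁ ≤ j.val → 0 < μ * FadingBC.tail p (j.val + 1) →
            FadingBC.condEntropy (FadingBC.withFading p P) (fun ω => FadingBC.rvX ω j)
              (fun ω => (FadingBC.rvV ω, FadingBC.topBits j.val (FadingBC.rvX ω))) = 0))) ∧
    -- the rates of the bit assignments, and their achievability by superposition coding
    (∀ i₀ : ℕ, i₀ ≤ m₁ →
      FadingBC.mutualInfo (FadingBC.withFading p (FadingBC.bitLaw n m₁ i₀))
        (fun ω => FadingBC.uBits m₁ i₀ (FadingBC.rvX ω)) FadingBC.rvV = 0 ∧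
      FadingBC.mutualInfo (FadingBC.withFading p (FadingBC.bitLaw n m₁ i₀))
        (fun ω => FadingBC.uBits m₁ i₀ (FadingBC.rvX ω)) (FadingBC.rvY₁ m₁) = (m₁ : ℝ) - i₀ ∧
      FadingBC.condMutualInfo (FadingBC.withFading p (FadingBC.bitLaw n m₁ i₀))
        FadingBC.rvX (FadingBC.rvY₁ m₁) FadingBC.rvV = (m₁ : ℝ) - i₀ ∧
      FadingBC.mutualInfo (FadingBC.withFading p (FadingBC.bitLaw n m₁ i₀))
        FadingBC.rvV FadingBC.rvY₂ = FadingBC.rate₂ m₁ p i₀ ∧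
      FadingBC.rectangle m₁ p i₀ ⊆ FadingBC.fixedSuperpositionRegion m₁ p i₀) ∧
    -- the Körner–Marton bound, the superposition region and the capacity region coincide
    FadingBC.explicitRegion m₁ p =
      {R : ℝ × ℝ | 0 ≤ R.1 ∧ 0 ≤ R.2 ∧
        ∀ μ : ℝ, 0 ≤ μ → R.1 + μ * R.2 ≤ FadingBC.optValue m₁ p μ} ∧
    FadingBC.kornerMartonTwo m₁ p = FadingBC.explicitRegion m₁ p ∧
    FadingBC.kornerMartonRegion m₁ p = FadingBC.explicitRegion m₁ p ∧
    FadingBC.superpositionRegion m₁ p = FadingBC.explicitRegion m₁ p ∧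
    FadingBC.capacityRegion m₁ p = FadingBC.explicitRegion m₁ p := by
  refine ⟨fun μ hμ => ⟨⟨?_, ?_⟩, FadingBC.existsUnique_isThreshold hp hμ,
    fun i₀ hi => FadingBC.objective_bitLaw hmn.le hp hμ hi, fun V _ P hP hopt j => ?_⟩,
    fun i₀ hi => ⟨FadingBC.mutualInfo_uBits_rvV hp, FadingBC.mutualInfo_uBits_rvY₁ hi hmn.le hp,
      FadingBC.condMutualInfo_bitLaw hi hmn.le hp, FadingBC.mutualInfo_bitLaw hi hp,
      FadingBC.rectangle_subset_fixedSuperpositionRegion hp hmn.le (hm.trans hmn) hi⟩,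
    FadingBC.explicitRegion_eq_dualRegion hmn.le hp, ?_, ?_, ?_, ?_⟩
  · obtain ⟨i₀, hi, -⟩ := FadingBC.existsUnique_isThreshold (m₁ := m₁) hp hμ
    exact ⟨_, inferInstance, FadingBC.bitLaw n m₁ i₀, FadingBC.bitLaw_mem_stdSimplex m₁ i₀,
      (FadingBC.objective_bitLaw hmn.le hp hμ hi).symm⟩
  · rintro r ⟨V, _, P, hP, rfl⟩
    exact FadingBC.objective_le_optValue hp hP hmn.le hμ
  · obtain ⟨h1, h2, h3, h4⟩ := FadingBC.optimality_conditions hp hP hmn.le hμ hopt j.2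
    rw [FadingBC.condEntropy_withFading_bit hp hP, FadingBC.condEntropy_withFading_rvV_bit hp hP]
    refine ⟨h1, fun hj hq => ?_, h3, h4⟩
    refine FadingBC.condEntropy_withFading_rvV_eq_zero hp hP j fun k hk => ?_
    -- the tail is larger at the preceding bits, so that they are above the threshold as well
    exact (FadingBC.optimality_conditions hp hP hmn.le hμ hopt (hk.trans_lt j.2)).2.1
      (hk.trans_lt hj) (hq.trans_le (mul_le_mul_of_nonneg_left
        (FadingBC.tail_antitone hp.1 (Nat.succ_le_succ hk)) hμ))
  · exact (FadingBC.explicitRegion_eq_dualRegion hmn.le hp ▸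
      FadingBC.kornerMartonTwo_subset hmn.le hp).antisymm
      (FadingBC.explicitRegion_subset_kornerMartonTwo hmn.le hp)
  · refine Set.Subset.antisymm ?_ (Set.subset_inter
      (FadingBC.explicitRegion_subset_kornerMartonTwo hmn.le hp)
      (FadingBC.explicitRegion_subset_kornerMartonOne hmn.le hp))
    rw [FadingBC.explicitRegion_eq_dualRegion hmn.le hp]
    exact Set.inter_subset_left.trans (FadingBC.kornerMartonTwo_subset hmn.le hp)
  · refine Set.Subset.antisymm ?_
      (FadingBC.explicitRegion_subset_superpositionRegion hp hmn.le (hm.trans hmn))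
    rw [FadingBC.explicitRegion_eq_dualRegion hmn.le hp]
    exact (FadingBC.superpositionRegion_subset_capacityRegion m₁ p).trans
      (FadingBC.capacityRegion_subset_dualRegion hmn.le hp)
  · refine Set.Subset.antisymm ?_
      ((FadingBC.explicitRegion_subset_superpositionRegion hp hmn.le (hm.trans hmn)).trans
        (FadingBC.superpositionRegion_subset_capacityRegion m₁ p))
    rw [FadingBC.explicitRegion_eq_dualRegion hmn.le hp]
    exact FadingBC.capacityRegion_subset_dualRegion hmn.le hp
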